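/- Let $\mathbb F_q$ be the finite field with $q$ elements, let $F_1\subsetneq\cdots\subsetneq F_\lambda\subseteq\mathbb F_q$ be subfields, let $\mu_1,\dots,\mu_\lambda$ be positive integers, and put $s_0=0$, $s_t=\mu_1+\cdots+\mu_t$ and $m=s_\lambda$. For $1\le k\le m$ let $t_k$ be the unique integer with $s_{t_k-1}<k\le s_{t_k}$, and put $A_k=F_{t_k}$ and $d_k=|A_k|$. Let $\mathcal A=A_1\times\cdots\times A_m=F_1^{\mu_1}\times\cdots\times F_\lambda^{\mu_\lambda}\subseteq\mathbb F_q^m$. Let $\mathrm{Aff}(\mathcal A)$ be the set of all maps $\phi:\mathcal A\to\mathcal A$ with $\phi(\mathcal A)=\mathcal A$ that are restrictions of maps $X\mapsto MX+b$ with $M\in\mathrm{GL}(m,\mathbb F_q)$ and $b\in\mathbb F_q^m$. For a prime power $Q$, let $\left[{a\atop b}\right]_{Q}$ denote the number of $b$-dimensional linear subspaces of $\mathbb F_Q^a$. Let $u=\sum_{i=1}^{j}(d_i-1)+\ell$ with $0\le j<m$ and $0<\ell\le d_{j+1}-1$ (the integers $j,\ell$ are uniquely determined by $u$). For $1\le k\le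 j+1$ with $d_k\ge d_{j+1}-\ell$, and for $\Omega\subseteq A_k$ with $|\Omega|=d_k-(d_{j+1}-\ell)$, put $$h_k^{\Omega}(X_1,\dots,X_m)=\prod_{\substack{i=1\\ i\ne k}}^{j+1}\bigl(1-X_i^{d_i-1}\bigr)\prod_{\omega\in\Omega}(X_k-\omega),$$ and let $N^{(k)}(u,\mathcal A)\subseteq\mathbb F_q^{\mathcal A}$ be the set of all words $\bigl(\gamma\,h_k^{\Omega}(\phi(P))\bigr)_{P\in\mathcal A}$, where $\gamma\in\mathbb F_q^*$, $\phi\in\mathrm{Aff}(\mathcal A)$, and $\Omega$ runs over all subsets of $A_k$ of size $d_k-(d_{j+1}-\ell)$. **Theorem.** Let $r=t_{j+1}$ and suppose that $0<\ell<d_{j+1}-1$. Let $1\le k\le j+1$ be such that $t_k<r$ and $d_k>d_{j+1}-\ell$. Then $$\left|N^{(k)}(u,\mathcal A)\right|=(q-1)\Biggl(\prod_{\substack{i=1\\ i\neq k}}^{j+1}d_i\Biggr)\Biggl(\prod_{i=s_{t_k}+1}^{j+1}d_i\Biggr)\left[{\mu_r\atop j+1-s_{r-1}}\right]_{d_{j+1}}\left[{\mu_{t_k}\atop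 1}\right]_{d_k}\binom{d_k}{d_{j+1}-\ell}.$$ -/

import Mathlib

open scoped Matrix

/-- A chain `F_1 ⊊ ⋯ ⊊ F_lam` of subfields of `F` with positive multiplicities `μ_1, …, μ_lam`.
It encodes `𝒜 = F_1^{μ_1} × ⋯ × F_lam^{μ_lam}`. All indices are 1-based, as in the literature;
values of `fld` and `mult` outside `1, …, lam` are irrelevant. -/
structure NestedProduct (F : Type*) [Field F] where
  lam : ℕ
  fld : ℕ → Subfield F
  mult : ℕ → ℕ
  mult_pos : ∀ t ∈ Set.Icc 1 lam, 0 < mult t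
  strictMonoOn : StrictMonoOn fld (Set.Icc 1 lam)

/-- The affine group associated to `𝒜 ⊆ F^ι`: all maps `φ : 𝒜 → 𝒜` with `φ(𝒜) = 𝒜` which are
restrictions of some `X ↦ M X + b` in `AGL(ι, F)`. -/
def affineGroupOf {F ι : Type*} [Field F] [Fintype ι] [DecidableEq ι] (𝒜 : Set (ι → F)) :
    Set (𝒜 → 𝒜) :=
  {φ | Function.Surjective φ ∧ ∃ M : Matrix.GeneralLinearGroup ι F, ∃ b : ι → F,
    ∀ P : 𝒜, (φ P : ι → F) = (M : Matrix ι ι F) *ᵥ (P : ι → F) + b}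

/-- The Gaussian binomial coefficient `[n, t]_q` with `q = |K|`: the number of `t`-dimensional
linear subspaces of `K^n`. -/
noncomputable def gaussBinom (K : Type*) [Field K] (n t : ℕ) : ℕ :=
  Nat.card {W : Submodule K (Fin n → K) // Module.finrank K W = t}

namespace NestedProduct

variable {F : Type*} [Field F] (D : NestedProduct F)

/-- `s_t = μ_1 + ⋯ + μ_t`. -/
def s (t : ℕ) : ℕ := ∑ i ∈ Finset.Icc 1 t, D.mult i

/-- The number `m = s_lam` of coordinates. -/
def m : ℕ := D.s D.lam

/-- `t_k`, the unique `t` with `s_{t-1} < k ≤ s_t` (for `1 ≤ k ≤ m`). -/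
noncomputable def t (k : ℕ) : ℕ := sInf {t | k ≤ D.s t}

theorem t_spec {k : ℕ} (h1 : 1 ≤ k) (hm : k ≤ D.m) :
    D.t k ∈ Set.Icc 1 D.lam ∧ D.s (D.t k - 1) < k ∧ k ≤ D.s (D.t k) := by
  have hle : k ≤ D.s (D.t k) := Nat.sInf_mem (s := {t | k ≤ D.s t}) ⟨D.lam, hm⟩
  have hpos : 1 ≤ D.t k := by
    by_contra h
    have h0 : D.t k = 0 := by omega
    rw [h0] at hle
    simp [s] at hle
    omega
  refine ⟨⟨hpos, Nat.sInf_le (s := {t | k ≤ D.s t}) hm⟩, ?_, hle⟩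
  have hlt : D.t k - 1 < sInf {t | k ≤ D.s t} := by
    change D.t k - 1 < D.t k
    omega
  simpa using Nat.notMem_of_lt_sInf hlt

/-- The factor `A_i = F_{t_i}`, for `1 ≤ i ≤ m`. -/
noncomputable def A (i : ℕ) : Subfield F := D.fld (D.t i)

/-- `d_i = |A_i|`. -/
noncomputable def d (i : ℕ) : ℕ := Nat.card (D.A i)

/-- The index set `{1, …, m}` of the coordinates. -/
abbrev Coord : Type := Finset.Icc 1 D.m

/-- The product `𝒜 = A_1 × ⋯ × A_m ⊆ F^m`. -/
def prod : Set (D.Coord → F) := {P | ∀ i : D.Coord, P i ∈ D.A i}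

/-- `h_k^Ω = ∏_{i ≤ j+1, i ≠ k} (1 - X_i^{d_i - 1}) · ∏_{ω ∈ Ω} (X_k - ω)`. -/
noncomputable def h (j : ℕ) (k : D.Coord) (Ω : Finset F) : MvPolynomial D.Coord F :=
  (∏ i ∈ Finset.univ.filter (fun i : D.Coord => (i : ℕ) ≤ j + 1 ∧ i ≠ k),
      (1 - MvPolynomial.X i ^ (D.d i - 1))) *
    ∏ ω ∈ Ω, (MvPolynomial.X k - MvPolynomial.C ω)

/-- `N^{(k, Ω)}`: the words `(f(P))_{P ∈ 𝒜}` of the functions `f = γ · (h_k^Ω ∘ φ)` on `𝒜`, with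
`γ ∈ F^*` and `φ` in the affine group associated to `𝒜`. -/
def NOmega (j : ℕ) (k : D.Coord) (Ω : Finset F) : Set (D.prod → F) :=
  {c | ∃ γ : F, γ ≠ 0 ∧ ∃ φ ∈ affineGroupOf D.prod,
    c = fun P => γ * MvPolynomial.eval (φ P : D.Coord → F) (D.h j k Ω)}

/-- `u = ∑_{i ≤ j} (d_i - 1) + ℓ` with `0 ≤ j < m` and `0 < ℓ ≤ d_{j+1} - 1`; such a pair `(j, ℓ)`
is unique. -/
def IsDecomp (u j ℓ : ℕ) : Prop :=
  j < D.m ∧ 0 < ℓ ∧ ℓ ≤ D.d (j + 1) - 1 ∧ u = (∑ i ∈ Finset.Icc 1 j, (D.d i - 1)) + ℓ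

/-- `N^{(k)}(u, 𝒜)`: the union of the `N^{(k, Ω)}` over all `Ω ⊆ A_k` of size
`d_k - (d_{j+1} - ℓ)`, where `(j, ℓ)` is the decomposition of `u` and `k ≤ j + 1`. -/
def N (k : D.Coord) (u : ℕ) : Set (D.prod → F) :=
  {c | ∃ j ℓ : ℕ, D.IsDecomp u j ℓ ∧ (k : ℕ) ≤ j + 1 ∧
    ∃ Ω : Finset F, (Ω : Set F) ⊆ (D.A k : Set F) ∧ Ω.card + (D.d (j + 1) - ℓ) = D.d k ∧
      c ∈ D.NOmega j k Ω}

end NestedProduct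

/-! On `𝒜` the factor `1 - X_i^(d_i - 1)` is the indicator of `X_i = 0`. An affine bijection of `𝒜`
has the form `P ↦ M (P - b)`, where `M` and `N = M⁻¹` preserve `𝒜` and are therefore block
triangular for the levels (`Preserves.eq_zero`). So a word is supported on parallel flats `b + y x1
+ W`, `y ∈ A_k`, with value `γ ∏ (y - ω)` there. Here `x1 = N e_k` vanishes below level `t_k` but
not on it, and the flat is zero below level `r`, free above it, and a subspace of codimension `j + 1
- s_{r-1}` on it (`InvPair.exists_flat`, `InvPair.isWord`). All such data occur
(`exists_invPair_of_data`).

The data are redundant only through affine changes of `y` (`IsWord.reparam`) and shifts of `b`, `x1`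
inside the flat (`IsWord.translate`). `Param` removes this freedom: on level `t_k` the velocity is a
chosen generator of a line and the base point lies in a complement of that line; on level `r` both
lie in a complement of `W`. Since `ℓ < d_{j+1} - 1`, at least two `y` are not roots, which is enough
to recover all parameters (`Param.ext_of_isWord`). Words thus biject with a product of finite sets.
Base point and velocity both have coordinates on the levels after `t_k`, whence the second product
in the formula. -/

/-! ### Linear algebra: counting subspaces, transitivity of the general linear group. -/

section LinearAlgebra

open Module

variable {K V V' : Type*} [Field K] [AddCommGroup V] [Module K V] [AddCommGroup V'] [Module K V']

theorem Submodule.card_finrank_eq_congr (e : V ≃ₗ[K] V') (t : ℕ) :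
    Nat.card {W : Submodule K V // finrank K W = t} =
      Nat.card {W : Submodule K V' // finrank K W = t} :=
  Nat.card_congr <| (Submodule.orderIsoMapComap e).toEquiv.subtypeEquiv fun W => by
    change _ ↔ finrank K (W.map (e : V →ₗ[K] V')) = t
    rw [LinearEquiv.finrank_map_eq]

/-- Annihilators exchange dimension and codimension, and `V` is isomorphic to its dual. -/
theorem Submodule.card_finrank_add_eq [FiniteDimensional K V] (t : ℕ) :
    Nat.card {W : Submodule K V // finrank K W + t = finrank K V} =
      Nat.card {W : Submodule K V // finrank K W = t} := by
  classical
  rw [Submodule.card_finrank_eq_congr (Basis.ofVectorSpace K V).toDualEquiv]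
  refine Nat.card_congr (((Subspace.orderIsoFiniteDimensional (K := K) (V := V)).toEquiv.trans
    OrderDual.ofDual).subtypeEquiv fun W => ?_)
  change _ ↔ finrank K W.dualAnnihilator = t
  have := Subspace.finrank_add_finrank_dualAnnihilator_eq W
  omega

theorem card_finrank_eq_gaussBinom {ι : Type*} [Finite ι] (t : ℕ) :
    Nat.card {W : Submodule K (ι → K) // finrank K W = t} = gaussBinom K (Nat.card ι) t :=
  Submodule.card_finrank_eq_congr (LinearEquiv.funCongrLeft K K (Finite.equivFin ι).symm) t

theorem card_finrank_add_eq_gaussBinom {ι : Type*} [Finite ι] (t : ℕ) :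
    Nat.card {W : Submodule K (ι → K) // finrank K W + t = Nat.card ι} =
      gaussBinom K (Nat.card ι) t := by
  have : Fintype ι := Fintype.ofFinite ι
  rw [← card_finrank_eq_gaussBinom, ← Submodule.card_finrank_add_eq, finrank_pi,
    Nat.card_eq_fintype_card (α := ι)]

/-- A parametrization of a complement of a subspace by coordinates. -/
theorem Submodule.exists_injective_isCompl_range [FiniteDimensional K V] (U : Submodule K V)
    {n : ℕ} (hn : finrank K U + n = finrank K V) :
    ∃ κ : (Fin n → K) →ₗ[K] V, Function.Injective κ ∧ IsCompl (LinearMap.range κ) U := by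
  obtain ⟨C, hC⟩ := Submodule.exists_isCompl U
  have h := Submodule.finrank_add_eq_of_isCompl hC
  let e : (Fin n → K) ≃ₗ[K] C := LinearEquiv.ofFinrankEq _ _ (by rw [finrank_fin_fun]; omega)
  refine ⟨C.subtype ∘ₗ e, C.injective_subtype.comp e.injective, ?_⟩
  rw [LinearMap.range_comp_of_range_eq_top _ e.range, Submodule.range_subtype]
  exact hC.symm

/-- The general linear group is transitive on subspaces of a given dimension. -/
theorem Submodule.exists_linearEquiv_mem_iff [FiniteDimensional K V] {U W : Submodule K V}
    (h : finrank K U = finrank K W) : ∃ g : V ≃ₗ[K] V, ∀ x, g x ∈ W ↔ x ∈ U := by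
  let f : U ≃ₗ[K] W := LinearEquiv.ofFinrankEq _ _ h
  obtain ⟨g, hg⟩ := Submodule.exists_linearEquiv_restrict_eq f
  refine ⟨g, fun x => ⟨fun hx => ?_, fun hx => ?_⟩⟩
  · have : g (f.symm ⟨g x, hx⟩) = g x := by rw [← hg, f.apply_symm_apply]
    rw [← g.injective this]
    exact (f.symm _).2
  · rw [← hg ⟨x, hx⟩]
    exact (f _).2

/-- The general linear group is transitive on nonzero vectors. -/
theorem exists_linearEquiv_apply_eq_of_ne_zero {x y : V} (hx : x ≠ 0) (hy : y ≠ 0) :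
    ∃ g : V ≃ₗ[K] V, g x = y := by
  let f := (LinearEquiv.toSpanNonzeroSingleton K V x hx).symm.trans
    (LinearEquiv.toSpanNonzeroSingleton K V y hy)
  obtain ⟨g, hg⟩ := Submodule.exists_linearEquiv_restrict_eq f
  refine ⟨g, ?_⟩
  have h1 := hg (LinearEquiv.toSpanNonzeroSingleton K V x hx 1)
  rw [LinearEquiv.trans_apply, LinearEquiv.symm_apply_apply] at h1
  simpa using h1.symm

/-- The subspace of vectors vanishing at the coordinates in `p`. -/
def vanishingOn (K : Type*) [Field K] {ι : Type*} (p : ι → Prop) : Submodule K (ι → K) where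
  carrier := {x | ∀ i, p i → x i = 0}
  add_mem' hx hy i hi := by simp [hx i hi, hy i hi]
  zero_mem' _ _ := rfl
  smul_mem' c x hx i hi := by simp [hx i hi]

theorem mem_vanishingOn {ι : Type*} {p : ι → Prop} {x : ι → K} :
    x ∈ vanishingOn K p ↔ ∀ i, p i → x i = 0 := Iff.rfl

theorem finrank_ker_add_card {ι κ : Type*} [Finite ι] [Finite κ]
    (f : (ι → K) →ₗ[K] (κ → K)) (hf : Function.Surjective f) :
    finrank K (LinearMap.ker f) + Nat.card κ = Nat.card ι := by
  have := Fintype.ofFinite ι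
  have := Fintype.ofFinite κ
  have h := LinearMap.finrank_range_add_finrank_ker f
  rw [LinearMap.range_eq_top.2 hf, finrank_top, finrank_pi, finrank_pi] at h
  rw [Nat.card_eq_fintype_card, Nat.card_eq_fintype_card]
  omega

theorem finrank_vanishingOn_add {ι : Type*} [Finite ι] (p : ι → Prop) :
    finrank K (vanishingOn K p) + Nat.card {i // p i} = Nat.card ι := by
  rw [← finrank_ker_add_card (LinearMap.funLeft K K (Subtype.val : {i // p i} → ι))
    (LinearMap.funLeft_surjective_of_injective _ _ _ Subtype.val_injective)]
  have : vanishingOn K p = LinearMap.ker (LinearMap.funLeft K K (Subtype.val : {i // p i} → ι)) := by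
    ext x
    simp [mem_vanishingOn, funext_iff, LinearMap.funLeft_apply]
  rw [this]

end LinearAlgebra

/-! ### Matrices and affine maps preserving a product of nested subfields; flats. -/

/-- A product of subfields of `F` indexed by `ι`, where the subfield at the coordinate `i` grows
strictly with the level of `i`, together with a distinguished set `low` of coordinates filling the
levels below `r` and possibly a part of level `r`, a coordinate `top` of level `r`, and a coordinate
`k` of level below `r`. -/
structure Staircase (F ι : Type*) [Field F] where
  fld : ℕ → Subfield F
  lev : ι → ℕ
  fld_lt : ∀ i i', lev i < lev i' → fld (lev i) < fld (lev i')
  r : ℕ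
  low : ι → Prop
  low_of_lt : ∀ i, lev i < r → low i
  lev_le_of_low : ∀ i, low i → lev i ≤ r
  top : ι
  lev_top : lev top = r
  k : ι
  lev_k_lt : lev k < r

namespace Staircase

variable {F ι : Type*} [Field F] (S : Staircase F ι)

/-- The product of the subfields. -/
def prod : Set (ι → F) := {P | ∀ i, P i ∈ S.fld (S.lev i)}

/-- The subfield at `k`. -/
abbrev K : Subfield F := S.fld (S.lev S.k)

/-- The subfield at the top level. -/
abbrev L : Subfield F := S.fld S.r

/-- The coordinates of the level of `k`. -/
abbrev B : Type _ := {i : ι // S.lev i = S.lev S.k}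

/-- The coordinates of the top level. -/
abbrev E : Type _ := {i : ι // S.lev i = S.r}

variable {S}

theorem low_k : S.low S.k := S.low_of_lt _ S.lev_k_lt

theorem fld_le {i i' : ι} (h : S.lev i ≤ S.lev i') : S.fld (S.lev i) ≤ S.fld (S.lev i') := by
  rcases h.eq_or_lt with h | h
  · rw [h]
  · exact (S.fld_lt _ _ h).le

theorem K_le_L : S.K ≤ S.L := by
  have h := S.lev_k_lt
  rw [← S.lev_top] at h
  have := fld_le h.le
  rwa [S.lev_top] at this

theorem zero_mem_prod : (0 : ι → F) ∈ S.prod := fun _ => zero_mem _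

theorem add_mem_prod {x y : ι → F} (hx : x ∈ S.prod) (hy : y ∈ S.prod) : x + y ∈ S.prod :=
  fun i => add_mem (hx i) (hy i)

theorem sub_mem_prod {x y : ι → F} (hx : x ∈ S.prod) (hy : y ∈ S.prod) : x - y ∈ S.prod :=
  fun i => sub_mem (hx i) (hy i)

/-- The product is not stable under `K`: the fields below the level of `k` are too small, so the
vector has to vanish there. -/
theorem smul_mem_prod {x : ι → F} (hx : x ∈ S.prod) (h0 : ∀ i, S.lev i < S.lev S.k → x i = 0)
    {y : F} (hy : y ∈ S.K) : y • x ∈ S.prod := fun i => by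
  rcases lt_or_ge (S.lev i) (S.lev S.k) with h | h
  · simp [h0 i h]
  · exact mul_mem (fld_le h hy) (hx i)

theorem single_mem_prod [DecidableEq ι] {i : ι} {a : F} (ha : a ∈ S.fld (S.lev i)) :
    Pi.single i a ∈ S.prod := fun i' => by
  by_cases h : i' = i
  · subst h; simpa using ha
  · simp [h]

variable [Fintype ι] [DecidableEq ι]

variable (S) in
/-- The matrices mapping the product of the subfields to itself. -/
def Preserves (M : Matrix ι ι F) : Prop := ∀ P ∈ S.prod, M *ᵥ P ∈ S.prod

theorem Preserves.entry_mul_mem {M : Matrix ι ι F} (hM : S.Preserves M) (i c : ι) {a : F}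
    (ha : a ∈ S.fld (S.lev c)) : M i c * a ∈ S.fld (S.lev i) := by
  simpa using hM _ (single_mem_prod ha) i

theorem Preserves.entry_mem {M : Matrix ι ι F} (hM : S.Preserves M) (i c : ι) :
    M i c ∈ S.fld (S.lev i) := by
  simpa using hM.entry_mul_mem i c (one_mem _)

/-- Dividing by a nonzero entry would put the larger subfield inside the smaller one. Hence the
matrices are block triangular. -/
theorem Preserves.eq_zero {M : Matrix ι ι F} (hM : S.Preserves M) {i c : ι}
    (h : S.lev i < S.lev c) : M i c = 0 := by
  by_contra h0
  refine (S.fld_lt _ _ h).not_ge fun a ha => ?_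
  have := mul_mem (inv_mem (hM.entry_mem i c)) (hM.entry_mul_mem i c ha)
  rwa [inv_mul_cancel_left₀ h0] at this

/-- A triangular matrix does not let levels `≥ n` influence levels `< n`. -/
theorem Preserves.mulVec_eq_zero {M : Matrix ι ι F} (hM : S.Preserves M) {x : ι → F} {i : ι}
    (hx : ∀ c, S.lev c ≤ S.lev i → x c = 0) : (M *ᵥ x) i = 0 := by
  refine Finset.sum_eq_zero fun c _ => ?_
  rcases le_or_gt (S.lev c) (S.lev i) with h | h
  · simp [hx c h]
  · simp [hM.eq_zero h]

variable (S) in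
/-- Mutually inverse matrices preserving the product of the subfields. -/
structure InvPair (M N : Matrix ι ι F) : Prop where
  left : S.Preserves M
  right : S.Preserves N
  mul : M * N = 1
  mul' : N * M = 1

theorem InvPair.mulVec_mulVec {M N : Matrix ι ι F} (h : S.InvPair M N) (x : ι → F) :
    M *ᵥ N *ᵥ x = x := by
  rw [Matrix.mulVec_mulVec, h.mul, Matrix.one_mulVec]

theorem InvPair.mulVec_mulVec' {M N : Matrix ι ι F} (h : S.InvPair M N) (x : ι → F) :
    N *ᵥ M *ᵥ x = x := by
  rw [Matrix.mulVec_mulVec, h.mul', Matrix.one_mulVec]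

/-- Taking `b` to be a preimage of `0` makes the map linear in `P - b`, so `M` itself preserves the
product; surjectivity gives the same for the inverse. -/
theorem exists_invPair_of_mem_affineGroupOf [Finite F] {φ : S.prod → S.prod}
    (hφ : φ ∈ affineGroupOf S.prod) :
    ∃ M N b, S.InvPair M N ∧ b ∈ S.prod ∧ ∀ P : S.prod, (φ P : ι → F) = M *ᵥ (P - b : ι → F) := by
  obtain ⟨hsurj, M, b', hM⟩ := hφ
  obtain ⟨b, hb⟩ := hsurj ⟨0, zero_mem_prod⟩
  have hb0 : (M : Matrix ι ι F) *ᵥ (b : ι → F) + b' = 0 := by rw [← hM, hb]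
  have key : ∀ P : S.prod, (φ P : ι → F) = (M : Matrix ι ι F) *ᵥ (P - b : ι → F) := fun P => by
    rw [hM, Matrix.mulVec_sub, eq_neg_of_add_eq_zero_right hb0, sub_eq_add_neg]
  have h1 : (M : Matrix ι ι F) * (M⁻¹ : Matrix.GeneralLinearGroup ι F) = 1 := by
    rw [← Matrix.GeneralLinearGroup.coe_mul, mul_inv_cancel, Matrix.GeneralLinearGroup.coe_one]
  have h2 : (M⁻¹ : Matrix.GeneralLinearGroup ι F) * (M : Matrix ι ι F) = 1 := by
    rw [← Matrix.GeneralLinearGroup.coe_mul, inv_mul_cancel, Matrix.GeneralLinearGroup.coe_one]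
  refine ⟨M, (M⁻¹ : Matrix.GeneralLinearGroup ι F), b, ⟨fun P hP => ?_, fun Q hQ => ?_, h1, h2⟩,
    b.2, key⟩
  · have := (φ ⟨P + b, add_mem_prod hP b.2⟩).2
    rw [key] at this
    simpa using this
  · obtain ⟨P, hP⟩ := hsurj ⟨Q, hQ⟩
    have h := key P
    rw [hP] at h
    change Q = _ at h
    rw [h, Matrix.mulVec_mulVec, h2, Matrix.one_mulVec]
    exact sub_mem_prod P.2 b.2

theorem InvPair.exists_mem_affineGroupOf {M N : Matrix ι ι F} (h : S.InvPair M N) {b : ι → F}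
    (hb : b ∈ S.prod) : ∃ φ ∈ affineGroupOf S.prod, ∀ P : S.prod,
      (φ P : ι → F) = M *ᵥ (P - b : ι → F) := by
  refine ⟨fun P => ⟨M *ᵥ (P - b : ι → F), h.left _ (sub_mem_prod P.2 hb)⟩, ⟨fun Q => ?_, ?_⟩,
    fun _ => rfl⟩
  · refine ⟨⟨N *ᵥ Q + b, add_mem_prod (h.right _ Q.2) hb⟩, Subtype.ext ?_⟩
    simp [h.mul]
  · exact ⟨⟨M, N, h.mul, h.mul'⟩, -(M *ᵥ b), fun P => by
      rw [← sub_eq_add_neg, ← Matrix.mulVec_sub]⟩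

variable (S) in
/-- The vectors of the product which vanish below level `r` and lie in `W` at level `r`. -/
def InFlat (W : Submodule S.L (S.E → S.L)) (z : ι → F) : Prop :=
  z ∈ S.prod ∧ (∀ i, S.lev i < S.r → z i = 0) ∧ ∃ w ∈ W, ∀ i : S.E, z i = w i

omit [Fintype ι] [DecidableEq ι]

theorem InFlat.add {W : Submodule S.L (S.E → S.L)} {x y : ι → F} (hx : S.InFlat W x)
    (hy : S.InFlat W y) : S.InFlat W (x + y) := by
  obtain ⟨hx0, hx1, w, hw, hxw⟩ := hx
  obtain ⟨hy0, hy1, v, hv, hyv⟩ := hy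
  exact ⟨add_mem_prod hx0 hy0, fun i hi => by simp [hx1 i hi, hy1 i hi], w + v, add_mem hw hv,
    fun i => by simp [hxw, hyv]⟩

theorem InFlat.neg {W : Submodule S.L (S.E → S.L)} {x : ι → F} (hx : S.InFlat W x) :
    S.InFlat W (-x) := by
  obtain ⟨hx0, hx1, w, hw, hxw⟩ := hx
  exact ⟨fun i => neg_mem (hx0 i), fun i hi => by simp [hx1 i hi], -w, neg_mem hw,
    fun i => by simp [hxw]⟩

theorem InFlat.smul {W : Submodule S.L (S.E → S.L)} {x : ι → F} (hx : S.InFlat W x) (y : S.K) :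
    S.InFlat W ((y : F) • x) := by
  obtain ⟨hx0, hx1, w, hw, hxw⟩ := hx
  exact ⟨smul_mem_prod hx0 (fun i hi => hx1 i (hi.trans S.lev_k_lt)) y.2,
    fun i hi => by simp [hx1 i hi], (⟨y, K_le_L y.2⟩ : S.L) • w, W.smul_mem _ hw,
    fun i => by simp [hxw]⟩

theorem InFlat.zero {W : Submodule S.L (S.E → S.L)} : S.InFlat W 0 :=
  ⟨zero_mem_prod, fun _ _ => rfl, 0, zero_mem _, fun _ => rfl⟩

end Staircase

/-! ### From matrices to flats and velocities, and back. -/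

theorem Fintype.sum_eq_sum_subtype {ι M : Type*} [Fintype ι] [AddCommMonoid M] (p : ι → Prop)
    [DecidablePred p] (f : ι → M) (h : ∀ i, ¬ p i → f i = 0) : ∑ i, f i = ∑ i : {i // p i}, f i := by
  rw [← Fintype.sum_subtype_add_sum_subtype p f,
    Finset.sum_eq_zero (fun i _ => h i i.2 : ∀ i ∈ Finset.univ, f (i : {i // ¬ p i}) = 0), add_zero]

namespace Staircase

variable {F ι : Type*} [Field F] {S : Staircase F ι}

theorem mem_fld_of_eq {n n' : ℕ} (h : n = n') {a : F} (ha : a ∈ S.fld n) : a ∈ S.fld n' := h ▸ ha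

/-- The restriction to the top level of a vector of the product. -/
def resE {z : ι → F} (hz : z ∈ S.prod) : S.E → S.L := fun i => ⟨z i, mem_fld_of_eq i.2 (hz i)⟩

/-- The restriction to the level of `k` of a vector of the product. -/
def resB {z : ι → F} (hz : z ∈ S.prod) : S.B → S.K := fun i => ⟨z i, mem_fld_of_eq i.2 (hz i)⟩

variable [Fintype ι] [DecidableEq ι]

theorem Preserves.mulVec_apply_of_lev_eq {M : Matrix ι ι F} (hM : S.Preserves M) {z : ι → F}
    (hz : ∀ i, S.lev i < S.r → z i = 0) {i : ι} (hi : S.lev i = S.r) :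
    (M *ᵥ z) i = ∑ c : S.E, M i c * z c := by
  rw [Matrix.mulVec_eq_sum, Finset.sum_apply]
  rw [Fintype.sum_eq_sum_subtype (fun c => S.lev c = S.r)]
  · simp
  · intro c hc
    rcases Nat.lt_or_gt_of_ne hc with h | h
    · simp [hz c h]
    · simp [hM.eq_zero (hi ▸ h : S.lev i < S.lev c)]

open Classical in
-- By triangularity of `N`, vanishing of `M z` below level `r` forces `z` to vanish there. The low
-- rows of level `r` then see only the coordinates of level `r`, and `W` is the kernel of the
-- resulting map over `L`.
theorem InvPair.exists_flat {M N : Matrix ι ι F} (h : S.InvPair M N) :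
    ∃ W : Submodule S.L (S.E → S.L),
      Module.finrank S.L W + Nat.card {i : S.E // S.low i} = Nat.card S.E ∧
      ∀ z ∈ S.prod, S.InFlat W z ↔ ∀ i, S.low i → (M *ᵥ z) i = 0 := by
  let Me : Matrix {i : S.E // S.low i} S.E S.L := fun i c => ⟨M i c, mem_fld_of_eq i.1.2 (h.left.entry_mem i c)⟩
  have hMe : ∀ (w : S.E → S.L) (i), ((Me.mulVecLin w i : S.L) : F) = ∑ c : S.E, M i c * w c := by
    intro w i
    rw [Matrix.mulVecLin_apply, Matrix.mulVec, dotProduct]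
    push_cast
    rfl
  refine ⟨LinearMap.ker Me.mulVecLin, finrank_ker_add_card _ fun u => ?_, fun z hz => ⟨?_, fun h0 => ?_⟩⟩
  -- Surjectivity, which gives the codimension: extend `u` by zero to `Q`. Since `N Q` vanishes
  -- below level `r`, its top part is a preimage of `u`.
  · let Q : ι → F := fun i => if hi : S.lev i = S.r ∧ S.low i then u ⟨⟨i, hi.1⟩, hi.2⟩ else 0
    have hQ : Q ∈ S.prod := fun i => by
      by_cases hi : S.lev i = S.r ∧ S.low i
      · simp only [Q, dif_pos hi]
        exact mem_fld_of_eq hi.1.symm (u _).2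
      · simp only [Q, dif_neg hi]
        exact zero_mem _
    have hP := h.right Q hQ
    have hP0 : ∀ i, S.lev i < S.r → (N *ᵥ Q) i = 0 := fun i hi =>
      h.right.mulVec_eq_zero fun c hc => dif_neg fun h' => by omega
    refine ⟨resE hP, funext fun i => Subtype.ext ?_⟩
    rw [hMe]
    refine (h.left.mulVec_apply_of_lev_eq hP0 i.1.2).symm.trans ?_
    rw [h.mulVec_mulVec]
    exact dif_pos ⟨i.1.2, i.2⟩
  · rintro ⟨-, hz0, w, hw, hzw⟩ i hi
    rcases (S.lev_le_of_low i hi).lt_or_eq with hlt | heq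
    · exact h.left.mulVec_eq_zero fun c hc => hz0 c (hc.trans_lt hlt)
    · rw [h.left.mulVec_apply_of_lev_eq hz0 heq]
      have := congrArg Subtype.val (congrFun (LinearMap.mem_ker.1 hw) ⟨⟨i, heq⟩, hi⟩)
      rw [hMe] at this
      simpa [hzw] using this
  · have hz0 : ∀ i, S.lev i < S.r → z i = 0 := fun i hi => by
      rw [← h.mulVec_mulVec' z]
      exact h.right.mulVec_eq_zero fun c hc => h0 c (S.low_of_lt _ (hc.trans_lt hi))
    refine ⟨hz, hz0, resE hz, LinearMap.mem_ker.2 (funext fun i => Subtype.ext ?_), fun i => rfl⟩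
    rw [hMe]
    exact (h.left.mulVec_apply_of_lev_eq hz0 i.1.2).symm.trans (h0 _ i.2)

/-- The product is finite, so an injective self-map of it is onto, and the inverse matrix preserves
it too. -/
theorem Preserves.exists_invPair [Finite F] {N : Matrix ι ι F} (hN : S.Preserves N)
    (hinj : ∀ x, N *ᵥ x = 0 → x = 0) : ∃ M, S.InvPair M N := by
  have hinj' : Function.Injective N.mulVec := fun x y hxy => by
    refine sub_eq_zero.1 (hinj _ ?_)
    rw [Matrix.mulVec_sub, sub_eq_zero]
    exact hxy
  have hu : IsUnit N.det := N.isUnit_iff_isUnit_det.1 (Matrix.mulVec_injective_iff_isUnit.1 hinj')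
  refine ⟨N⁻¹, fun P hP => ?_, hN, N.nonsing_inv_mul hu, N.mul_nonsing_inv hu⟩
  let f : S.prod → S.prod := fun Q => ⟨N *ᵥ Q, hN _ Q.2⟩
  have hf : Function.Surjective f := Finite.injective_iff_surjective.1 fun x y hxy =>
    Subtype.ext (hinj' (congrArg Subtype.val hxy))
  obtain ⟨Q, hQ⟩ := hf ⟨P, hP⟩
  have hQ' : N *ᵥ Q = P := congrArg Subtype.val hQ
  rw [← hQ', Matrix.mulVec_mulVec, N.nonsing_inv_mul hu, Matrix.one_mulVec]
  exact Q.2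

omit [Fintype ι] [DecidableEq ι] in
/-- An automorphism of a vector space over a subfield extends to the ambient field. -/
theorem exists_matrix_of_linearEquiv {κ : Type*} [Fintype κ] [DecidableEq κ] {A : Subfield F}
    (g : (κ → A) ≃ₗ[A] (κ → A)) : ∃ G : Matrix κ κ F, (∀ x, G *ᵥ x = 0 → x = 0) ∧
      ∀ x : κ → A, G *ᵥ (fun i => (x i : F)) = fun i => (g x i : F) := by
  let G := LinearMap.toMatrix' (g : (κ → A) →ₗ[A] (κ → A))
  refine ⟨G.map A.subtype, fun x hx => ?_, fun x => funext fun i => ?_⟩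
  · refine Matrix.eq_zero_of_mulVec_eq_zero (M := G.map A.subtype) ?_ hx
    have h1 : G.det ≠ 0 := by
      rw [LinearMap.det_toMatrix']
      exact g.isUnit_det'.ne_zero
    have h2 := RingHom.map_det A.subtype G
    rw [RingHom.mapMatrix_apply] at h2
    rw [← h2]
    exact (map_ne_zero _).2 h1
  · have h1 : G *ᵥ x = g x := LinearMap.toMatrix'_mulVec _ _
    have h2 := RingHom.map_mulVec A.subtype G x i
    rw [h1] at h2
    exact h2.symm

open Classical in
-- `N` acts by `g` on the level of `k`, taking `e_k` to the part of `x1` there, and by `h` on level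
-- `r`, taking the coordinate subspace to `W`. A shear along `X_k` supplies the other coordinates of
-- `x1`.
theorem exists_invPair_of_data [Finite F] {x1 : ι → F} (hx1 : x1 ∈ S.prod)
    (hx10 : ∀ i, S.lev i < S.lev S.k → x1 i = 0) (hne : ∃ i, S.lev i = S.lev S.k ∧ x1 i ≠ 0)
    {W : Submodule S.L (S.E → S.L)}
    (hW : Module.finrank S.L W + Nat.card {i : S.E // S.low i} = Nat.card S.E) :
    ∃ M N, S.InvPair M N ∧ N *ᵥ Pi.single S.k 1 = x1 ∧
      ∀ z ∈ S.prod, S.InFlat W z ↔ ∀ i, S.low i → (M *ᵥ z) i = 0 := by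
  have hkr := S.lev_k_lt
  obtain ⟨g, hg⟩ := exists_linearEquiv_apply_eq_of_ne_zero (K := S.K)
    (x := (Pi.single ⟨S.k, rfl⟩ 1 : S.B → S.K)) (y := resB hx1) (by simp) (by
      obtain ⟨i, hi, hi0⟩ := hne
      exact fun h => hi0 (congrArg Subtype.val (congrFun h ⟨i, hi⟩)))
  obtain ⟨h, hh⟩ := Submodule.exists_linearEquiv_mem_iff (K := S.L)
    (U := vanishingOn S.L (fun i : S.E => S.low i)) (W := W) (by
      have := finrank_vanishingOn_add (K := S.L) (fun i : S.E => S.low i)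
      omega)
  obtain ⟨G, hG0, hG⟩ := exists_matrix_of_linearEquiv g
  obtain ⟨H, hH0, hH⟩ := exists_matrix_of_linearEquiv h
  -- No shear term is needed on the level of `k`, where `G` already produces `x1`; below that level
  -- the term is zero.
  let T : (ι → F) →ₗ[F] (ι → F) :=
    { toFun := fun X i =>
        if hB : S.lev i = S.lev S.k then (G *ᵥ fun c => X c) ⟨i, hB⟩
        else if hE : S.lev i = S.r then (H *ᵥ fun c => X c) ⟨i, hE⟩ + x1 i * X S.k
        else X i + x1 i * X S.k
      map_add' := fun X Y => funext fun i => by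
        have e1 : G *ᵥ (fun c : S.B => (X + Y) c) = G *ᵥ (fun c => X c) + G *ᵥ fun c => Y c :=
          G.mulVec_add _ _
        have e2 : H *ᵥ (fun c : S.E => (X + Y) c) = H *ᵥ (fun c => X c) + H *ᵥ fun c => Y c :=
          H.mulVec_add _ _
        rw [e1, e2]
        simp only [Pi.add_apply]
        split_ifs <;> ring
      map_smul' := fun a X => funext fun i => by
        have e1 : G *ᵥ (fun c : S.B => (a • X) c) = a • (G *ᵥ fun c => X c) := G.mulVec_smul _ _
        have e2 : H *ᵥ (fun c : S.E => (a • X) c) = a • (H *ᵥ fun c => X c) := H.mulVec_smul _ _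
        rw [e1, e2]
        simp only [Pi.smul_apply, smul_eq_mul, RingHom.id_apply]
        split_ifs <;> ring }
  have hTB : ∀ X (i : S.B), T X i = (G *ᵥ fun c => X c) i := fun X i => dif_pos i.2
  have hTE : ∀ X (i : S.E), T X i = (H *ᵥ fun c => X c) i + x1 i * X S.k := fun X i => by
    have hi := i.2
    exact (dif_neg (by omega)).trans (dif_pos i.2)
  have hT : ∀ X (i : ι), S.lev i ≠ S.lev S.k → S.lev i ≠ S.r → T X i = X i + x1 i * X S.k :=
    fun X i h1 h2 => (dif_neg h1).trans (dif_neg h2)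
  have hTB' : ∀ {X} (hX : X ∈ S.prod) (i : S.B), T X i = g (resB hX) i := fun {X} hX i =>
    (hTB X i).trans (congrFun (hG (resB hX)) i)
  have hTE' : ∀ {X} (hX : X ∈ S.prod) (i : S.E), T X i = h (resE hX) i + x1 i * X S.k :=
    fun {X} hX i => by rw [hTE X i]; exact congrArg (· + _) (congrFun (hH (resE hX)) i)
  have hB0 : ∀ X, (∀ i, S.lev i = S.lev S.k → T X i = 0) → ∀ i, S.lev i = S.lev S.k → X i = 0 :=
    fun X hX i hi => congrFun (hG0 (fun c : S.B => X c) (funext fun c => by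
      rw [← hTB]; exact hX c c.2)) ⟨i, hi⟩
  let N := LinearMap.toMatrix' T
  have hNT : ∀ X, N *ᵥ X = T X := fun X => LinearMap.toMatrix'_mulVec _ _
  have hN : S.Preserves N := fun X hX i => by
    rw [hNT]
    by_cases hB : S.lev i = S.lev S.k
    · rw [hTB' hX ⟨i, hB⟩, hB]
      exact SetLike.coe_mem _
    have hsec : x1 i * X S.k ∈ S.fld (S.lev i) := by
      rcases lt_or_gt_of_ne hB with hlt | hgt
      · rw [hx10 i hlt, zero_mul]
        exact zero_mem _
      · exact mul_mem (hx1 i) (fld_le hgt.le (hX _))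
    by_cases hE : S.lev i = S.r
    · rw [hTE' hX ⟨i, hE⟩]
      refine add_mem ?_ hsec
      rw [hE]
      exact SetLike.coe_mem _
    · rw [hT X i hB hE]
      exact add_mem (hX i) hsec
  obtain ⟨M, hMN⟩ := hN.exists_invPair fun X hX => by
    rw [hNT] at hX
    have h1 := hB0 X (fun i _ => congrFun hX i)
    have hk : X S.k = 0 := h1 _ rfl
    have h2 := hH0 (fun c : S.E => X c) (funext fun c => by
      have := hTE X c
      rw [hX, hk, mul_zero, add_zero] at this
      exact this.symm)
    funext i
    by_cases hB : S.lev i = S.lev S.k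
    · exact h1 i hB
    by_cases hE : S.lev i = S.r
    · exact congrFun h2 ⟨i, hE⟩
    · have := hT X i hB hE
      rw [hX, hk, mul_zero, add_zero] at this
      exact this.symm
  refine ⟨M, N, hMN, ?_, fun z hz => ?_⟩
  · have hmem : (Pi.single S.k 1 : ι → F) ∈ S.prod := single_mem_prod (one_mem _)
    have e1 : resB hmem = (Pi.single ⟨S.k, rfl⟩ 1 : S.B → S.K) := funext fun i => by
      by_cases hi : i = ⟨S.k, rfl⟩
      · subst hi; exact Subtype.ext (by simp [resB])
      · have : (i : ι) ≠ S.k := fun h' => hi (Subtype.ext h')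
        exact Subtype.ext (by simp [resB, hi, this])
    have e2 : resE hmem = 0 := funext fun i => by
      have : (i : ι) ≠ S.k := fun h' => by have := i.2; rw [h'] at this; omega
      exact Subtype.ext (by simp [resE, this])
    rw [hNT]
    funext i
    by_cases hB : S.lev i = S.lev S.k
    · rw [hTB' hmem ⟨i, hB⟩, e1, hg]
      rfl
    by_cases hE : S.lev i = S.r
    · rw [hTE' hmem ⟨i, hE⟩, e2]
      simp
    · have hik : i ≠ S.k := fun h' => hB (by rw [h'])
      rw [hT _ i hB hE]
      simp [hik]
  · have hX := hMN.left z hz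
    have hz' : T (M *ᵥ z) = z := by rw [← hNT, hMN.mulVec_mulVec']
    -- With `z = T X`, the claim is that `T X` lies in the flat exactly when the low coordinates of
    -- `X` vanish.
    generalize M *ᵥ z = X at hX hz'
    subst hz'
    constructor
    · rintro ⟨-, h0, w, hw, hwT⟩ i hi
      have hXB := hB0 X fun i hi => h0 i (by omega)
      have hk : X S.k = 0 := hXB _ rfl
      rcases (S.lev_le_of_low i hi).lt_or_eq with hlt | heq
      · by_cases hB : S.lev i = S.lev S.k
        · exact hXB i hB
        · have := hT X i hB hlt.ne
          rw [h0 i hlt, hk, mul_zero, add_zero] at this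
          exact this.symm
      · have hwh : h (resE hX) = w := funext fun c => Subtype.ext (by
          rw [← hwT, hTE' hX, hk, mul_zero, add_zero])
        have := (hh _).1 (hwh ▸ hw)
        exact congrArg Subtype.val (this ⟨i, heq⟩ hi)
    · intro h0
      have hk : X S.k = 0 := h0 _ low_k
      refine ⟨hz, fun i hi => ?_, h (resE hX), (hh _).2 fun i hi => Subtype.ext (h0 i hi),
        fun i => by rw [hTE' hX, hk, mul_zero, add_zero]⟩
      by_cases hB : S.lev i = S.lev S.k
      · have : resB hX = 0 := funext fun c => Subtype.ext (h0 c (S.low_of_lt _ (by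
          have := c.2; omega)))
        rw [hTB' hX ⟨i, hB⟩, this]
        simp
      · rw [hT X i hB hi.ne, h0 i (S.low_of_lt _ hi), hk]
        simp

end Staircase

/-! ### Words as functions on families of parallel flats, and normalized parameters. -/

namespace Staircase

variable {F ι : Type*} [Field F] {S : Staircase F ι}

variable (S) in
/-- The word `c` is supported on the flats `x0 + y x1 + W` with `y ∈ K`, where it takes the value
`γ ∏_{ω ∈ Ω} (y - ω)`. -/
structure IsWord (c : S.prod → F) (x0 x1 : ι → F) (W : Submodule S.L (S.E → S.L)) (γ : F)
    (Ω : Finset F) : Prop where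
  eq : ∀ (P : S.prod) (y : S.K), S.InFlat W (P - x0 - (y : F) • x1 : ι → F) →
    c P = γ * ∏ ω ∈ Ω, ((y : F) - ω)
  eq_zero : ∀ P : S.prod, (∀ y : S.K, ¬ S.InFlat W (P - x0 - (y : F) • x1 : ι → F)) → c P = 0

theorem IsWord.unique {c c' : S.prod → F} {x0 x1 : ι → F} {W : Submodule S.L (S.E → S.L)} {γ : F}
    {Ω : Finset F} (h : S.IsWord c x0 x1 W γ Ω) (h' : S.IsWord c' x0 x1 W γ Ω) : c = c' := by
  funext P
  by_cases hP : ∃ y : S.K, S.InFlat W (P - x0 - (y : F) • x1 : ι → F)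
  · obtain ⟨y, hy⟩ := hP
    rw [h.eq P y hy, h'.eq P y hy]
  · have hP := not_exists.1 hP
    rw [h.eq_zero P hP, h'.eq_zero P hP]

/-- Substituting `β + α y` for `y` keeps the family of flats; each root moves to `(ω - β) / α` and
each factor releases one `α`. -/
theorem IsWord.reparam [DecidableEq F] {c : S.prod → F} {x0 x1 : ι → F}
    {W : Submodule S.L (S.E → S.L)} {γ : F}
    {Ω : Finset F} (h : S.IsWord c x0 x1 W γ Ω) {α : S.K} (hα : α ≠ 0) (β : S.K) :
    S.IsWord c (x0 + (β : F) • x1) ((α : F) • x1) W (γ * (α : F) ^ Ω.card)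
      (Ω.image fun ω => (ω - β) / α) := by
  have hα' : (α : F) ≠ 0 := fun h => hα (Subtype.ext h)
  have key : ∀ (P : S.prod) (y : S.K), (P - (x0 + (β : F) • x1) - (y : F) • (α : F) • x1 : ι → F) =
      P - x0 - ((β + y * α : S.K) : F) • x1 := fun P y => by
    push_cast
    module
  refine ⟨fun P y hy => ?_, fun P hP => h.eq_zero P fun y hy => ?_⟩
  · rw [key] at hy
    rw [h.eq P _ hy, Finset.prod_image, mul_assoc, ← Finset.prod_const, ← Finset.prod_mul_distrib]
    · congr 1
      refine Finset.prod_congr rfl fun ω _ => ?_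
      push_cast
      field_simp
      ring
    · intro a _ b _ hab
      simpa [div_left_inj' hα'] using hab
  · refine hP ((y - β) / α) ?_
    rw [key]
    have : β + (y - β) / α * α = y := by field_simp; ring
    rwa [this]

/-- The flat is an additive group stable under `K`, so none of its cosets `x0 + y x1 + W` changes.
-/
theorem IsWord.translate {c : S.prod → F} {x0 x1 x0' x1' : ι → F}
    {W : Submodule S.L (S.E → S.L)} {γ : F} {Ω : Finset F} (h : S.IsWord c x0 x1 W γ Ω)
    (h0 : S.InFlat W (x0' - x0)) (h1 : S.InFlat W (x1' - x1)) : S.IsWord c x0' x1' W γ Ω := by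
  refine ⟨fun P y hy => h.eq P y ?_, fun P hP => h.eq_zero P fun y hy => hP y ?_⟩
  · convert (hy.add h0).add (h1.smul y) using 1
    module
  · convert (hy.add h0.neg).add (h1.smul y).neg using 1
    module

open Classical in
-- Applying `M` to `P - b - y x1` gives `φ P - y e_k`, so the coset with parameter `y` is where `φ
-- P` agrees with `y e_k` on the low coordinates.
theorem InvPair.isWord [Fintype ι] [DecidableEq ι] {M N : Matrix ι ι F} (h : S.InvPair M N)
    {b : ι → F} (hb : b ∈ S.prod) {W : Submodule S.L (S.E → S.L)}
    (hW : ∀ z ∈ S.prod, S.InFlat W z ↔ ∀ i, S.low i → (M *ᵥ z) i = 0) {φ : S.prod → S.prod}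
    (hφ : ∀ P : S.prod, (φ P : ι → F) = M *ᵥ (P - b : ι → F)) {γ : F} {Ω : Finset F}
    {c : S.prod → F} (hc : ∀ P, c P = γ * if ∀ i, S.low i → i ≠ S.k → (φ P : ι → F) i = 0 then
      ∏ ω ∈ Ω, ((φ P : ι → F) S.k - ω) else 0) :
    S.IsWord c b (N *ᵥ Pi.single S.k 1) W γ Ω := by
  have key : ∀ (P : S.prod) (y : S.K),
      S.InFlat W (P - b - (y : F) • (N *ᵥ Pi.single S.k 1) : ι → F) ↔
        (∀ i, S.low i → i ≠ S.k → (φ P : ι → F) i = 0) ∧ (φ P : ι → F) S.k = y := fun P y => by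
    rw [hW _ (sub_mem_prod (sub_mem_prod P.2 hb) (smul_mem_prod
      (h.right _ (single_mem_prod (one_mem _))) (fun i hi => h.right.mulVec_eq_zero fun c hc => ?_)
      y.2)), Matrix.mulVec_sub, Matrix.mulVec_smul, h.mulVec_mulVec, ← hφ]
    · constructor
      · intro h0
        refine ⟨fun i hi hik => ?_, ?_⟩
        · simpa [hik] using h0 i hi
        · simpa [sub_eq_zero] using h0 _ low_k
      · rintro ⟨h0, hk⟩ i hi
        by_cases hik : i = S.k
        · subst hik; simp [hk]
        · simp [h0 i hi hik, hik]
    · rw [Pi.single_eq_of_ne]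
      rintro rfl
      omega
  refine ⟨fun P y hy => ?_, fun P hP => ?_⟩
  · obtain ⟨h0, hk⟩ := (key P y).1 hy
    rw [hc, if_pos h0, hk]
  · rw [hc, if_neg, mul_zero]
    exact fun h0 => hP ⟨_, (φ P).2 S.k⟩ ((key P _).2 ⟨h0, rfl⟩)

variable (S) in
/-- Assembling a vector from its coordinates below the level of `k`, at the level of `k`, strictly
between this level and the top level, and at the top level. -/
noncomputable def assemble (a : ∀ i : {i // S.lev i < S.lev S.k}, S.fld (S.lev i)) (b : S.B → S.K)
    (x : ∀ i : {i // S.lev S.k < S.lev i ∧ S.lev i < S.r}, S.fld (S.lev i)) (e : S.E → S.L) :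
    ι → F := fun i =>
  if h : S.lev i < S.lev S.k then a ⟨i, h⟩
  else if hB : S.lev i = S.lev S.k then b ⟨i, hB⟩
  else if hr : S.lev i < S.r then x ⟨i, by omega, hr⟩
  else if hE : S.lev i = S.r then e ⟨i, hE⟩
  else 0

section assemble

variable (a : ∀ i : {i // S.lev i < S.lev S.k}, S.fld (S.lev i)) (b : S.B → S.K)
  (x : ∀ i : {i // S.lev S.k < S.lev i ∧ S.lev i < S.r}, S.fld (S.lev i)) (e : S.E → S.L)

theorem assemble_low (i : {i // S.lev i < S.lev S.k}) : S.assemble a b x e i = a i := dif_pos i.2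

theorem assemble_B (i : S.B) : S.assemble a b x e i = b i :=
  (dif_neg (by have := i.2; omega)).trans (dif_pos i.2)

theorem assemble_mid (i : {i // S.lev S.k < S.lev i ∧ S.lev i < S.r}) :
    S.assemble a b x e i = x i :=
  (dif_neg (by have := i.2; omega)).trans ((dif_neg (by have := i.2; omega)).trans (dif_pos i.2.2))

theorem assemble_E (i : S.E) : S.assemble a b x e i = e i := by
  have h1 := i.2
  have h2 := S.lev_k_lt
  exact (dif_neg (by omega)).trans ((dif_neg (by omega)).trans ((dif_neg (by omega)).trans
    (dif_pos i.2)))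

theorem assemble_mem : S.assemble a b x e ∈ S.prod := fun i => by
  unfold assemble
  split_ifs with h hB hr hE
  · exact SetLike.coe_mem _
  · exact mem_fld_of_eq hB.symm (SetLike.coe_mem _)
  · exact SetLike.coe_mem _
  · exact mem_fld_of_eq hE.symm (SetLike.coe_mem _)
  · exact zero_mem _

end assemble

theorem inFlat_assemble {W : Submodule S.L (S.E → S.L)} {w : S.E → S.L} (hw : w ∈ W) :
    S.InFlat W (S.assemble 0 0 0 w) :=
  ⟨assemble_mem _ _ _ _, fun i hi => by
    rcases lt_trichotomy (S.lev i) (S.lev S.k) with h | h | h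
    · exact assemble_low _ _ _ _ ⟨i, h⟩
    · exact assemble_B _ _ _ _ ⟨i, h⟩
    · exact assemble_mid _ _ _ _ ⟨i, h, hi⟩, w, hw, assemble_E _ _ _ _⟩

/-- A vector of the product agrees modulo a flat with a vector assembled from coordinates. -/
theorem inFlat_assemble_sub {W : Submodule S.L (S.E → S.L)} {z : ι → F} (hz : z ∈ S.prod)
    {e : S.E → S.L} (he : resE hz - e ∈ W) :
    S.InFlat W (S.assemble (fun i => ⟨z i, hz i⟩) (resB hz) (fun i => ⟨z i, hz i⟩) e - z) :=
  ⟨sub_mem_prod (assemble_mem _ _ _ _) hz, fun i hi => by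
    rw [Pi.sub_apply, sub_eq_zero]
    rcases lt_trichotomy (S.lev i) (S.lev S.k) with h | h | h
    · exact assemble_low _ _ _ _ ⟨i, h⟩
    · exact assemble_B _ _ _ _ ⟨i, h⟩
    · exact assemble_mid _ _ _ _ ⟨i, h, hi⟩, -(resE hz - e), neg_mem he, fun i => by
    rw [Pi.sub_apply, assemble_E]
    simp [resE]⟩

variable (S) in
/-- The directions of lines at the level of `k`. -/
abbrev Direction : Type _ := {D : Submodule S.K (S.B → S.K) // Module.finrank S.K D = 1}

variable (S) in
/-- The subspaces of codimension `n` at the top level. -/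
abbrev Cosubspace (n : ℕ) : Type _ :=
  {W : Submodule S.L (S.E → S.L) // Module.finrank S.L W + n = Nat.card S.E}

theorem Direction.exists_gen (D : S.Direction) : ∃ v ∈ D.1, v ≠ 0 ∧ ∀ x ∈ D.1, ∃ a : S.K, a • v = x := by
  obtain ⟨v, hv, h⟩ := finrank_eq_one_iff'.1 D.2
  exact ⟨v, v.2, fun h0 => hv (Subtype.ext h0), fun x hx => by
    obtain ⟨a, ha⟩ := h ⟨x, hx⟩
    exact ⟨a, congrArg Subtype.val ha⟩⟩

noncomputable def Direction.gen (D : S.Direction) : S.B → S.K := D.exists_gen.choose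

theorem Direction.gen_mem (D : S.Direction) : D.gen ∈ D.1 := D.exists_gen.choose_spec.1

theorem Direction.gen_ne_zero (D : S.Direction) : D.gen ≠ 0 := D.exists_gen.choose_spec.2.1

theorem Direction.exists_smul_gen (D : S.Direction) {x : S.B → S.K} (hx : x ∈ D.1) :
    ∃ a : S.K, a • D.gen = x := D.exists_gen.choose_spec.2.2 x hx

theorem Direction.exists_compl [Finite ι] (D : S.Direction) :
    ∃ κ : (Fin (Nat.card S.B - 1) → S.K) →ₗ[S.K] (S.B → S.K),
      Function.Injective κ ∧ IsCompl (LinearMap.range κ) D.1 := by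
  have := Fintype.ofFinite S.B
  refine D.1.exists_injective_isCompl_range ?_
  rw [D.2, Module.finrank_pi, Nat.card_eq_fintype_card]
  have : 0 < Fintype.card S.B := Fintype.card_pos_iff.2 ⟨⟨S.k, rfl⟩⟩
  omega

noncomputable def Direction.compl [Finite ι] (D : S.Direction) :
    (Fin (Nat.card S.B - 1) → S.K) →ₗ[S.K] (S.B → S.K) := D.exists_compl.choose

theorem Direction.compl_injective [Finite ι] (D : S.Direction) : Function.Injective D.compl :=
  D.exists_compl.choose_spec.1

theorem Direction.isCompl [Finite ι] (D : S.Direction) : IsCompl (LinearMap.range D.compl) D.1 :=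
  D.exists_compl.choose_spec.2

theorem Cosubspace.exists_compl [Finite ι] {n : ℕ} (W : S.Cosubspace n) :
    ∃ κ : (Fin n → S.L) →ₗ[S.L] (S.E → S.L),
      Function.Injective κ ∧ IsCompl (LinearMap.range κ) W.1 := by
  have := Fintype.ofFinite S.E
  exact W.1.exists_injective_isCompl_range
    (by rw [W.2, Module.finrank_pi, Nat.card_eq_fintype_card])

noncomputable def Cosubspace.compl [Finite ι] {n : ℕ} (W : S.Cosubspace n) :
    (Fin n → S.L) →ₗ[S.L] (S.E → S.L) := W.exists_compl.choose

theorem Cosubspace.compl_injective [Finite ι] {n : ℕ} (W : S.Cosubspace n) :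
    Function.Injective W.compl := W.exists_compl.choose_spec.1

theorem Cosubspace.isCompl [Finite ι] {n : ℕ} (W : S.Cosubspace n) :
    IsCompl (LinearMap.range W.compl) W.1 := W.exists_compl.choose_spec.2

theorem Cosubspace.eq_of_compl_sub_mem [Finite ι] {n : ℕ} (W : S.Cosubspace n) {e e' : Fin n → S.L}
    (h : W.compl e - W.compl e' ∈ W.1) : e = e' := by
  rw [← map_sub] at h
  have h0 := Submodule.disjoint_def.1 W.isCompl.disjoint _ ⟨_, rfl⟩ h
  exact sub_eq_zero.1 (W.compl_injective (by rw [h0, map_zero]))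

theorem Cosubspace.exists_sub_compl_mem [Finite ι] {n : ℕ} (W : S.Cosubspace n) (x : S.E → S.L) :
    ∃ e, x - W.compl e ∈ W.1 := by
  obtain ⟨_, ⟨e, rfl⟩, w, hw, h⟩ := Submodule.mem_sup.1 (W.isCompl.sup_eq_top ▸ Submodule.mem_top (x := x))
  exact ⟨e, by rwa [← h, add_sub_cancel_left]⟩

variable (S) in
/-- Normalized parameters of words: a word is determined by a scalar, a set of roots, the direction
of a line at the level of `k`, a subspace at the top level, and the coordinates of a base point and
of a velocity. -/
@[ext]
structure Param (e n : ℕ) where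
  γ : Fˣ
  Ω : {Ω : Finset F // (Ω : Set F) ⊆ S.K ∧ Ω.card + e = Nat.card S.K}
  D : S.Direction
  W : S.Cosubspace n
  a : ∀ i : {i // S.lev i < S.lev S.k}, S.fld (S.lev i)
  b : Fin (Nat.card S.B - 1) → S.K
  x : ∀ i : {i // S.lev S.k < S.lev i ∧ S.lev i < S.r}, S.fld (S.lev i)
  v : ∀ i : {i // S.lev S.k < S.lev i ∧ S.lev i < S.r}, S.fld (S.lev i)
  xE : Fin n → S.L
  vE : Fin n → S.L

namespace Param

variable {e n : ℕ} [Finite ι] (p : S.Param e n)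

/-- The base point. -/
noncomputable def base : ι → F := S.assemble p.a (p.D.compl p.b) p.x (p.W.compl p.xE)

/-- The velocity. -/
noncomputable def vel : ι → F := S.assemble 0 p.D.gen p.v (p.W.compl p.vE)

theorem base_mem : p.base ∈ S.prod := assemble_mem _ _ _ _

theorem vel_mem : p.vel ∈ S.prod := assemble_mem _ _ _ _

theorem vel_eq_zero (i : ι) (hi : S.lev i < S.lev S.k) : p.vel i = 0 := assemble_low _ _ _ _ ⟨i, hi⟩

theorem add_mem (y : S.K) {z : ι → F} (hz : z ∈ S.prod) : p.base + (y : F) • p.vel + z ∈ S.prod :=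
  add_mem_prod (add_mem_prod p.base_mem (smul_mem_prod p.vel_mem p.vel_eq_zero y.2)) hz

/-- The word has the given parameters. -/
def IsWord (c : S.prod → F) : Prop := S.IsWord c p.base p.vel p.W.1 p.γ p.Ω.1

variable {p}

theorem IsWord.apply {c : S.prod → F} (h : p.IsWord c) (y : S.K) {z : ι → F}
    (hz : S.InFlat p.W.1 z) : c ⟨_, p.add_mem y hz.1⟩ = p.γ * ∏ ω ∈ p.Ω.1, ((y : F) - ω) := by
  refine h.eq _ y ?_
  convert hz using 1
  dsimp only
  module

/-- At a non-root the word is nonzero, so the point must lie in the support described by `p'`. -/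
theorem IsWord.exists_inFlat {p' : S.Param e n} {c : S.prod → F} (h : p.IsWord c)
    (h' : p'.IsWord c) {y : S.K} (hy : (y : F) ∉ p.Ω.1) {z : ι → F} (hz : S.InFlat p.W.1 z) :
    ∃ y' : S.K, S.InFlat p'.W.1 (p.base + (y : F) • p.vel + z - p'.base - (y' : F) • p'.vel) := by
  by_contra hcon
  have h0 := h'.eq_zero ⟨_, p.add_mem y hz.1⟩ (not_exists.1 hcon)
  rw [h.apply y hz, mul_eq_zero, Finset.prod_eq_zero_iff] at h0
  rcases h0 with h0 | ⟨ω, hω, h0⟩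
  · exact p.γ.ne_zero h0
  · rw [sub_eq_zero.1 h0] at hy
    exact hy hω

omit [Finite ι] in
-- Exactly `e` elements of `K` lie outside `Ω`.
theorem exists_ne_notMem [Finite F] (p : S.Param e n) (he : 2 ≤ e) :
    ∃ y y' : S.K, y ≠ y' ∧ (y : F) ∉ p.Ω.1 ∧ (y' : F) ∉ p.Ω.1 := by
  classical
  have := Fintype.ofFinite S.K
  let T : Finset S.K := Finset.univ.filter fun y => (y : F) ∉ p.Ω.1
  have h1 : (Finset.univ.filter fun y : S.K => (y : F) ∈ p.Ω.1).card = p.Ω.1.card := by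
    rw [← Finset.card_map (Function.Embedding.subtype _)]
    congr 1
    ext x
    simp only [Finset.mem_map, Finset.mem_filter, Finset.mem_univ, true_and]
    exact ⟨fun ⟨y, hy, h⟩ => h ▸ hy, fun hx => ⟨⟨x, p.Ω.2.1 hx⟩, hx, rfl⟩⟩
  have h2 := Finset.card_filter_add_card_filter_not (s := Finset.univ) (fun y : S.K => (y : F) ∈ p.Ω.1)
  have h3 := p.Ω.2.2
  rw [Finset.card_univ, ← Nat.card_eq_fintype_card] at h2
  have hT : 1 < T.card := by
    change 1 < (Finset.univ.filter fun y : S.K => (y : F) ∉ p.Ω.1).card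
    omega
  obtain ⟨y, hy, y', hy', hne⟩ := Finset.one_lt_card.1 hT
  exact ⟨y, y', hne, (Finset.mem_filter.1 hy).2, (Finset.mem_filter.1 hy').2⟩

end Param

end Staircase

/-! ### Uniqueness and existence of normalized parameters. -/

namespace Staircase

variable {F ι : Type*} [Field F] {S : Staircase F ι}

theorem InFlat.mem {W : Submodule S.L (S.E → S.L)} {z : ι → F} (hz : S.InFlat W z)
    {u : S.E → S.L} (hu : ∀ i : S.E, z i = u i) : u ∈ W := by
  obtain ⟨-, -, w, hw, hzw⟩ := hz
  have : u = w := funext fun i => Subtype.ext (by rw [← hu, hzw])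
  rwa [this]

namespace Param

variable {e n : ℕ} [Finite ι] {p p' : S.Param e n}

/-- Flats vanish on the level of `k`, so there congruence modulo a flat is equality. -/
theorem eq_on_B {y y' : S.K} {z : ι → F} (hz : S.InFlat p.W.1 z)
    (h : S.InFlat p'.W.1 (p.base + (y : F) • p.vel + z - p'.base - (y' : F) • p'.vel)) :
    p.D.compl p.b + y • p.D.gen = p'.D.compl p'.b + y' • p'.D.gen := by
  refine funext fun i => Subtype.ext ?_
  have hi : S.lev i < S.r := by rw [i.2]; exact S.lev_k_lt
  have h0 := h.2.1 i hi
  have hz0 := hz.2.1 i hi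
  simp only [Pi.sub_apply, Pi.add_apply, Pi.smul_apply, hz0, base, vel, assemble_B, smul_eq_mul,
    add_zero] at h0
  simp only [Pi.add_apply, Pi.smul_apply, smul_eq_mul, Subfield.coe_add, Subfield.coe_mul]
  linear_combination h0

/-- Two support points compared on the level of `k` give the direction, and the complement then
forces equal `b` and equal `y`. Varying the point of the flat recovers `W`, varying `y` the velocity
modulo the flat, and then the base point; the values give `Ω` and `γ`. Normalization turns
congruences into equalities. -/
theorem ext_of_isWord [Finite F] (he : 2 ≤ e) {c : S.prod → F} (h : p.IsWord c)
    (h' : p'.IsWord c) : p = p' := by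
  obtain ⟨y₁, y₂, hne, hy₁, hy₂⟩ := p.exists_ne_notMem he
  have hD : p.D = p'.D := by
    obtain ⟨y₁', h₁⟩ := h.exists_inFlat h' hy₁ InFlat.zero
    obtain ⟨y₂', h₂⟩ := h.exists_inFlat h' hy₂ InFlat.zero
    have h3 : (y₁ - y₂) • p.D.gen = (y₁' - y₂') • p'.D.gen := by
      rw [sub_smul, sub_smul]
      linear_combination eq_on_B InFlat.zero h₁ - eq_on_B InFlat.zero h₂
    have h4 : p.D.gen ∈ p'.D.1 :=
      (p'.D.1.smul_mem_iff (sub_ne_zero.2 hne)).1 (h3 ▸ p'.D.1.smul_mem _ p'.D.gen_mem)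
    refine Subtype.ext (Submodule.eq_of_le_of_finrank_eq (fun x hx => ?_) (p.D.2.trans p'.D.2.symm))
    obtain ⟨a, rfl⟩ := p.D.exists_smul_gen hx
    exact p'.D.1.smul_mem _ h4
  have hby : ∀ {y y' : S.K}, p.D.compl p.b + y • p.D.gen = p'.D.compl p'.b + y' • p'.D.gen →
      p.b = p'.b ∧ y = y' := fun {y y'} heq => by
    rw [← hD] at heq
    have h1 : p.D.compl (p.b - p'.b) = (y' - y) • p.D.gen := by
      rw [map_sub, sub_smul]
      linear_combination heq
    have h2 : p.D.compl (p.b - p'.b) = 0 := Submodule.disjoint_def.1 p.D.isCompl.disjoint _ ⟨_, rfl⟩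
      (h1 ▸ p.D.1.smul_mem _ p.D.gen_mem)
    refine ⟨sub_eq_zero.1 (p.D.compl_injective (by rw [h2, map_zero])), ?_⟩
    rw [h2] at h1
    exact (sub_eq_zero.1 ((smul_eq_zero.1 h1.symm).resolve_right p.D.gen_ne_zero)).symm
  have key : ∀ y : S.K, (y : F) ∉ p.Ω.1 → ∀ z, S.InFlat p.W.1 z →
      S.InFlat p'.W.1 (p.base + (y : F) • p.vel + z - p'.base - (y : F) • p'.vel) := by
    intro y hy z hz
    obtain ⟨y', hy'⟩ := h.exists_inFlat h' hy hz
    rwa [← (hby (eq_on_B hz hy')).2] at hy'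
  have hb : p.b = p'.b := (hby (eq_on_B InFlat.zero (key _ hy₁ _ InFlat.zero))).1
  have hW : p.W = p'.W := by
    refine Subtype.ext (Submodule.eq_of_le_of_finrank_eq (fun w hw => ?_)
      (Nat.add_right_cancel (p.W.2.trans p'.W.2.symm)))
    refine InFlat.mem (z := S.assemble 0 0 0 w) ?_ (assemble_E _ _ _ _)
    convert (key _ hy₁ _ (inFlat_assemble hw)).add (key _ hy₁ _ InFlat.zero).neg using 1
    module
  have hvel : S.InFlat p'.W.1 (p.vel - p'.vel) := by
    -- Subtracting the relations at `y₁` and `y₂` leaves `(y₁ - y₂)` times the difference of the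
    -- velocities.
    convert ((key _ hy₁ _ InFlat.zero).add (key _ hy₂ _ InFlat.zero).neg).smul (y₁ - y₂)⁻¹ using 1
    have hne' : (y₁ - y₂ : F) ≠ 0 := fun h => hne (Subtype.ext (sub_eq_zero.1 h))
    have : p.vel - p'.vel = ((y₁ - y₂ : F)⁻¹ * (y₁ - y₂ : F)) • (p.vel - p'.vel) := by
      rw [inv_mul_cancel₀ hne', one_smul]
    rw [this]
    push_cast
    module
  have hbase : S.InFlat p'.W.1 (p.base - p'.base) := by
    convert (key _ hy₁ _ InFlat.zero).add (hvel.smul y₁).neg using 1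
    module
  have hval : ∀ y : S.K, (p.γ : F) * ∏ ω ∈ p.Ω.1, ((y : F) - ω) =
      p'.γ * ∏ ω ∈ p'.Ω.1, ((y : F) - ω) := fun y => by
    rw [← h.apply y InFlat.zero]
    refine h'.eq _ y ?_
    convert hbase.add (hvel.smul y) using 1
    dsimp only
    module
  have hΩ : p.Ω = p'.Ω := by
    have hmem : ∀ (q : S.Param e n) (y : S.K),
        (q.γ : F) * ∏ ω ∈ q.Ω.1, ((y : F) - ω) = 0 ↔ (y : F) ∈ q.Ω.1 := fun q y => by
      simp [Finset.prod_eq_zero_iff, sub_eq_zero]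
    refine Subtype.ext (Finset.ext fun ω => ⟨fun hω => ?_, fun hω => ?_⟩)
    · have := (hmem p ⟨ω, p.Ω.2.1 hω⟩).2 hω
      rw [hval] at this
      exact (hmem p' _).1 this
    · have := (hmem p' ⟨ω, p'.Ω.2.1 hω⟩).2 hω
      rw [← hval] at this
      exact (hmem p _).1 this
  have hγ : p.γ = p'.γ := by
    have h1 := hval y₁
    rw [← hΩ] at h1
    refine Units.ext (mul_right_cancel₀ (Finset.prod_ne_zero_iff.2 fun ω hω h0 => ?_) h1)
    rw [sub_eq_zero.1 h0] at hy₁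
    exact hy₁ hω
  refine Param.ext hγ hΩ hD hW (funext fun i => Subtype.ext ?_) hb (funext fun i => Subtype.ext ?_)
    (funext fun i => Subtype.ext ?_) (p'.W.eq_of_compl_sub_mem ?_) (p'.W.eq_of_compl_sub_mem ?_)
  · simpa [base, assemble_low, sub_eq_zero] using hbase.2.1 i (i.2.trans S.lev_k_lt)
  · simpa [base, assemble_mid, sub_eq_zero] using hbase.2.1 i i.2.2
  · simpa [vel, assemble_mid, sub_eq_zero] using hvel.2.1 i i.2.2
  · exact hbase.mem fun i => by simp [base, assemble_E, hW]
  · exact hvel.mem fun i => by simp [vel, assemble_E, hW]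

end Param

open Classical in
variable (S) in
/-- The words obtained from the model words by affine maps preserving the product. -/
def words [Fintype ι] [DecidableEq ι] (e : ℕ) : Set (S.prod → F) :=
  {c | ∃ γ : F, γ ≠ 0 ∧ ∃ φ ∈ affineGroupOf S.prod, ∃ Ω : Finset F, (Ω : Set F) ⊆ S.K ∧
    Ω.card + e = Nat.card S.K ∧
    ∀ P, c P = γ * if ∀ i, S.low i → i ≠ S.k → (φ P : ι → F) i = 0 then
      ∏ ω ∈ Ω, ((φ P : ι → F) S.k - ω) else 0}

variable [Fintype ι] [DecidableEq ι] [Finite F] {e n : ℕ}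

theorem Param.exists_isWord (hn : Nat.card {i : S.E // S.low i} = n) (p : S.Param e n) :
    ∃ c ∈ S.words e, p.IsWord c := by
  obtain ⟨M, N, h, hN, hW⟩ := exists_invPair_of_data p.vel_mem p.vel_eq_zero (by
    by_contra hcon
    refine p.D.gen_ne_zero (funext fun i => Subtype.ext ?_)
    by_contra h0
    exact hcon ⟨i, i.2, by rwa [vel, assemble_B]⟩) (by rw [hn]; exact p.W.2)
  obtain ⟨φ, hφ, hφM⟩ := h.exists_mem_affineGroupOf p.base_mem
  refine ⟨_, ⟨p.γ, p.γ.ne_zero, φ, hφ, p.Ω.1, p.Ω.2.1, p.Ω.2.2, fun P => rfl⟩, ?_⟩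
  rw [IsWord, ← hN]
  exact h.isWord p.base_mem hW hφM fun P => rfl

theorem exists_param_of_mem_words (hn : Nat.card {i : S.E // S.low i} = n) {c : S.prod → F}
    (hc : c ∈ S.words e) : ∃ p : S.Param e n, p.IsWord c := by
  classical
  obtain ⟨γ, hγ, φ, hφ, Ω, hΩK, hΩ, hc⟩ := hc
  obtain ⟨M, N, b, h, hb, hφM⟩ := exists_invPair_of_mem_affineGroupOf hφ
  obtain ⟨W, hWn, hW⟩ := h.exists_flat
  have hw := h.isWord hb hW hφM hc
  set x1 := N *ᵥ Pi.single S.k 1 with hx1def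
  have hx1 : x1 ∈ S.prod := h.right _ (single_mem_prod (one_mem _))
  have hx10 : ∀ i, S.lev i < S.lev S.k → x1 i = 0 := fun i hi =>
    h.right.mulVec_eq_zero fun c hc => Pi.single_eq_of_ne (by rintro rfl; omega) _
  -- Otherwise triangularity would make `M x1 = e_k` vanish at `k`.
  have hx1B : resB hx1 ≠ 0 := fun h0 => by
    have h1 : (M *ᵥ x1) S.k = 0 := h.left.mulVec_eq_zero fun c hc => by
      rcases hc.lt_or_eq with hc | hc
      · exact hx10 c hc
      · exact congrArg Subtype.val (congrFun h0 ⟨c, hc⟩)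
    rw [hx1def, h.mulVec_mulVec] at h1
    simp at h1
  let D : S.Direction := ⟨S.K ∙ resB hx1, finrank_span_singleton hx1B⟩
  -- `α` rescales the velocity to the chosen generator; below, `t` is the component of `b` along
  -- `x1`, and the shift by `-t` moves the base point into the complement.
  obtain ⟨α, hα⟩ := Submodule.mem_span_singleton.1 D.gen_mem
  have hα0 : α ≠ 0 := by
    rintro rfl
    exact D.gen_ne_zero (by rw [← hα, zero_smul])
  obtain ⟨_, ⟨κ, rfl⟩, w, hwD, hκ⟩ := Submodule.mem_sup.1
    (D.isCompl.sup_eq_top ▸ Submodule.mem_top (x := resB hb))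
  obtain ⟨t, ht⟩ := Submodule.mem_span_singleton.1 hwD
  have hw' := hw.reparam hα0 (-t)
  have hx0' : b + ((-t : S.K) : F) • x1 ∈ S.prod := add_mem_prod hb (smul_mem_prod hx1 hx10 (-t).2)
  have hx1' : (α : F) • x1 ∈ S.prod := smul_mem_prod hx1 hx10 α.2
  have hB0 : resB hx0' = D.compl κ := by
    have : D.compl κ = resB hb - t • resB hx1 := by rw [← hκ, ← ht, add_sub_cancel_right]
    rw [this]
    refine funext fun i => Subtype.ext ?_
    simp [resB, sub_eq_add_neg]
  have hB1 : resB hx1' = D.gen := by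
    rw [← hα]
    exact funext fun i => Subtype.ext (by simp [resB])
  let W' : S.Cosubspace n := ⟨W, hn ▸ hWn⟩
  obtain ⟨e0, he0⟩ := W'.exists_sub_compl_mem (resE hx0')
  obtain ⟨e1, he1⟩ := W'.exists_sub_compl_mem (resE hx1')
  have h0 := inFlat_assemble_sub hx0' he0
  have h1 := inFlat_assemble_sub hx1' he1
  have hzero : (fun i : {i // S.lev i < S.lev S.k} => (⟨((α : F) • x1) i, hx1' i⟩ :
      S.fld (S.lev i))) = 0 := funext fun i => Subtype.ext (by simp [hx10 i i.2])
  rw [hB0] at h0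
  rw [hB1, hzero] at h1
  have hα' : (α : F) ≠ 0 := fun h => hα0 (Subtype.ext h)
  have hinj : Function.Injective fun ω : F => (ω - ((-t : S.K) : F)) / α := fun a b hab => by
    simpa [div_left_inj' hα'] using hab
  exact ⟨⟨Units.mk0 (γ * (α : F) ^ Ω.card) (mul_ne_zero hγ (pow_ne_zero _ hα')),
    ⟨_, fun x hx => by
      obtain ⟨ω, hω, rfl⟩ := Finset.mem_image.1 hx
      exact div_mem (sub_mem (hΩK hω) (-t).2) α.2,
      (congrArg (· + e) (Finset.card_image_of_injective Ω hinj)).trans hΩ⟩, D, W', _, κ, _, _, e0, e1⟩,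
    hw'.translate h0 h1⟩

theorem ncard_words (he : 2 ≤ e) (hn : Nat.card {i : S.E // S.low i} = n) :
    (S.words e).ncard = Nat.card (S.Param e n) := by
  choose f hf hfw using Param.exists_isWord (S := S) (e := e) hn
  refine (Nat.card_congr (Equiv.ofBijective (fun p => (⟨f p, hf p⟩ : S.words e)) ⟨?_, ?_⟩)).symm
  · intro p p' hpp
    have : f p = f p' := congrArg Subtype.val hpp
    exact Param.ext_of_isWord he (hfw p) (this ▸ hfw p')
  · rintro ⟨c, hc⟩
    obtain ⟨p, hp⟩ := exists_param_of_mem_words hn hc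
    exact ⟨p, Subtype.ext ((hfw p).unique hp)⟩

end Staircase

/-! ### Counting the parameters. -/

namespace Staircase

variable {F ι : Type*} [Field F] (S : Staircase F ι)

theorem card_roots [Finite F] (K : Subfield F) {e : ℕ} :
    Nat.card {Ω : Finset F // (Ω : Set F) ⊆ K ∧ Ω.card + e = Nat.card K} =
      (Nat.card K).choose e := by
  classical
  have := Fintype.ofFinite F
  have hK : (Finset.univ.filter (· ∈ K)).card = Nat.card K := by
    rw [Nat.card_eq_fintype_card, Fintype.card_subtype]
  have hle : ∀ Ω : Finset F, (Ω : Set F) ⊆ K ↔ Ω ⊆ Finset.univ.filter (· ∈ K) := fun Ω => by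
    simp [Set.subset_def, Finset.subset_iff]
  by_cases he : e ≤ Nat.card K
  · rw [← Nat.choose_symm he, ← hK, ← Finset.card_powersetCard, hK]
    refine Nat.subtype_card _ fun Ω => ?_
    rw [Finset.mem_powersetCard, hle]
    exact and_congr_right fun _ => by omega
  · rw [Nat.choose_eq_zero_of_lt (not_le.1 he), Nat.card_eq_zero]
    exact Or.inl ⟨fun Ω => by have := Ω.2.2; omega⟩

theorem card_param [Finite F] [Finite ι] (e n : ℕ) [Fintype {i // S.lev i < S.lev S.k}]
    [Fintype {i // S.lev S.k < S.lev i ∧ S.lev i < S.r}] :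
    Nat.card (S.Param e n) = (Nat.card F - 1) * (Nat.card S.K).choose e *
      gaussBinom S.K (Nat.card S.B) 1 * gaussBinom S.L (Nat.card S.E) n *
      (∏ i : {i // S.lev i < S.lev S.k}, Nat.card (S.fld (S.lev i))) *
      Nat.card S.K ^ (Nat.card S.B - 1) *
      (∏ i : {i // S.lev S.k < S.lev i ∧ S.lev i < S.r}, Nat.card (S.fld (S.lev i))) ^ 2 *
      (Nat.card S.L ^ n) ^ 2 := by
  let f : S.Param e n ≃ Fˣ × {Ω : Finset F // (Ω : Set F) ⊆ S.K ∧ Ω.card + e = Nat.card S.K} ×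
      S.Direction × S.Cosubspace n × (∀ i : {i // S.lev i < S.lev S.k}, S.fld (S.lev i)) ×
      (Fin (Nat.card S.B - 1) → S.K) ×
      (∀ i : {i // S.lev S.k < S.lev i ∧ S.lev i < S.r}, S.fld (S.lev i)) ×
      (∀ i : {i // S.lev S.k < S.lev i ∧ S.lev i < S.r}, S.fld (S.lev i)) ×
      (Fin n → S.L) × (Fin n → S.L) :=
    { toFun := fun p => (p.γ, p.Ω, p.D, p.W, p.a, p.b, p.x, p.v, p.xE, p.vE)
      invFun := fun q => ⟨q.1, q.2.1, q.2.2.1, q.2.2.2.1, q.2.2.2.2.1, q.2.2.2.2.2.1,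
        q.2.2.2.2.2.2.1, q.2.2.2.2.2.2.2.1, q.2.2.2.2.2.2.2.2.1, q.2.2.2.2.2.2.2.2.2⟩
      left_inv := fun _ => rfl
      right_inv := fun _ => rfl }
  rw [Nat.card_congr f]
  simp only [Nat.card_prod, Nat.card_pi, Nat.card_units, card_roots, card_finrank_eq_gaussBinom,
    card_finrank_add_eq_gaussBinom, Finset.prod_const, Finset.card_univ, Fintype.card_fin]
  ring

open Classical in
theorem prod_low_ne [Fintype ι] [DecidablePred fun i => S.low i ∧ i ≠ S.k]
    [DecidablePred fun i => S.low i ∧ S.lev S.k < S.lev i] :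
    ∏ i with S.low i ∧ i ≠ S.k, Nat.card (S.fld (S.lev i)) =
      (∏ i : {i // S.lev i < S.lev S.k}, Nat.card (S.fld (S.lev i))) *
        Nat.card S.K ^ (Nat.card S.B - 1) *
        ∏ i with S.low i ∧ S.lev S.k < S.lev i, Nat.card (S.fld (S.lev i)) := by
  have hkr := S.lev_k_lt
  have hlow := S.low_of_lt
  have e1 : (Finset.univ.filter fun i => S.low i ∧ i ≠ S.k) =
      (Finset.univ.filter fun i => S.lev i < S.lev S.k) ∪
        (Finset.univ.filter fun i => S.lev i = S.lev S.k).erase S.k ∪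
        Finset.univ.filter fun i => S.low i ∧ S.lev S.k < S.lev i := by
    ext i
    simp only [Finset.mem_filter, Finset.mem_univ, true_and, Finset.mem_union, Finset.mem_erase]
    have h1 := hlow i
    by_cases hik : i = S.k
    · subst hik; simp
    · rcases lt_trichotomy (S.lev i) (S.lev S.k) with h | h | h
      · simp [h, hik, h1 (by omega)]
      · simp [h, hik, h1 (by omega)]
      · simp [h, hik, h.not_gt, h.ne']
  rw [e1, Finset.prod_union, Finset.prod_union]
  · congr 1
    congr 1
    · exact Finset.prod_subtype _ (by simp) _
    · rw [Finset.prod_congr rfl (g := fun _ => Nat.card S.K), Finset.prod_const,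
        Finset.card_erase_of_mem (by simp), Nat.card_eq_fintype_card (α := S.B), Fintype.card_subtype]
      intro i hi
      rw [(Finset.mem_filter.1 (Finset.mem_erase.1 hi).2).2]
  · rw [Finset.disjoint_left]
    intro i h1 h2
    simp only [Finset.mem_filter, Finset.mem_erase] at h1 h2
    omega
  · rw [Finset.disjoint_left]
    intro i h1 h2
    simp only [Finset.mem_filter, Finset.mem_erase, Finset.mem_union] at h1 h2
    omega

open Classical in
theorem prod_low_gt [Fintype ι] [DecidablePred fun i => S.low i ∧ S.lev S.k < S.lev i] :
    ∏ i with S.low i ∧ S.lev S.k < S.lev i, Nat.card (S.fld (S.lev i)) =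
      (∏ i : {i // S.lev S.k < S.lev i ∧ S.lev i < S.r}, Nat.card (S.fld (S.lev i))) *
        Nat.card S.L ^ Nat.card {i : S.E // S.low i} := by
  have hkr := S.lev_k_lt
  have hlow := S.low_of_lt
  have e1 : (Finset.univ.filter fun i => S.low i ∧ S.lev S.k < S.lev i) =
      (Finset.univ.filter fun i => S.lev S.k < S.lev i ∧ S.lev i < S.r) ∪
        Finset.univ.filter fun i => S.lev i = S.r ∧ S.low i := by
    ext i
    simp only [Finset.mem_filter, Finset.mem_univ, true_and, Finset.mem_union]
    have h1 := hlow i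
    have h2 := S.lev_le_of_low i
    constructor
    · rintro ⟨h, h'⟩
      rcases (h2 h).lt_or_eq with h3 | h3
      · exact Or.inl ⟨h', h3⟩
      · exact Or.inr ⟨h3, h⟩
    · rintro (⟨h, h'⟩ | ⟨h, h'⟩)
      · exact ⟨h1 h', h⟩
      · exact ⟨h', by omega⟩
  rw [e1, Finset.prod_union]
  · congr 1
    · exact Finset.prod_subtype _ (by simp) _
    · rw [Finset.prod_congr rfl (g := fun _ => Nat.card S.L), Finset.prod_const,
        Nat.card_congr (Equiv.subtypeSubtypeEquivSubtypeInter (fun i => S.lev i = S.r) S.low),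
        Nat.card_eq_fintype_card (α := {i // S.lev i = S.r ∧ S.low i}), Fintype.card_subtype]
      intro i hi
      rw [(Finset.mem_filter.1 hi).2.1]
  · rw [Finset.disjoint_left]
    intro i h1 h2
    simp only [Finset.mem_filter] at h1 h2
    omega

/-- In `card_param` the middle levels and the low part of level `r` occur squared: one copy
completes the product over `i ≠ k`, the other is the product above the level of `k`. -/
theorem ncard_words_eq [Finite F] [Fintype ι] [DecidableEq ι]
    [DecidablePred fun i => S.low i ∧ i ≠ S.k]
    [DecidablePred fun i => S.low i ∧ S.lev S.k < S.lev i] {e : ℕ} (he : 2 ≤ e) :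
    (S.words e).ncard = (Nat.card F - 1) *
      (∏ i with S.low i ∧ i ≠ S.k, Nat.card (S.fld (S.lev i))) *
      (∏ i with S.low i ∧ S.lev S.k < S.lev i, Nat.card (S.fld (S.lev i))) *
      gaussBinom S.L (Nat.card S.E) (Nat.card {i : S.E // S.low i}) *
      gaussBinom S.K (Nat.card S.B) 1 * (Nat.card S.K).choose e := by
  classical
  rw [ncard_words he rfl, card_param, prod_low_ne, prod_low_gt]
  ring

end Staircase

/-! ### Translation back to the nested product. -/

namespace NestedProduct

variable {F : Type*} [Field F] (D : NestedProduct F)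

theorem s_mono : Monotone D.s := fun _ _ h =>
  Finset.sum_le_sum_of_subset (Finset.Icc_subset_Icc_right h)

variable {D}

theorem t_le_iff {i T : ℕ} (hi : i ≤ D.m) : D.t i ≤ T ↔ i ≤ D.s T :=
  ⟨fun h => (Nat.sInf_mem (s := {t | i ≤ D.s t}) ⟨D.lam, hi⟩).trans (D.s_mono h),
    fun h => Nat.sInf_le (s := {t | i ≤ D.s t}) h⟩

theorem t_mono {i i' : ℕ} (h : i ≤ i') (hi : i' ≤ D.m) : D.t i ≤ D.t i' :=
  (t_le_iff (h.trans hi)).2 (h.trans ((t_le_iff hi).1 le_rfl))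

theorem s_pred_add_mult {T : ℕ} (hT : 1 ≤ T) : D.s (T - 1) + D.mult T = D.s T := by
  obtain ⟨T, rfl⟩ := Nat.exists_eq_add_of_le' hT
  simp [s, Finset.sum_Icc_succ_top]

theorem t_eq_iff {i T : ℕ} (hi : i ≤ D.m) (hT : 1 ≤ T) :
    D.t i = T ↔ D.s (T - 1) < i ∧ i ≤ D.s T := by
  have h1 := t_le_iff (D := D) (T := T) hi
  have h2 := t_le_iff (D := D) (T := T - 1) hi
  omega

theorem card_coord (p : D.Coord → Prop) (s : Finset ℕ)
    (h : ∀ i, i ∈ s ↔ ∃ hi : i ∈ Finset.Icc 1 D.m, p ⟨i, hi⟩) : Nat.card {i // p i} = s.card := by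
  rw [← Fintype.card_coe s, ← Nat.card_eq_fintype_card]
  exact Nat.card_congr
    { toFun := fun i => ⟨i.1, (h _).2 ⟨i.1.2, i.2⟩⟩
      invFun := fun i => ⟨⟨i, ((h _).1 i.2).1⟩, ((h _).1 i.2).2⟩
      left_inv := fun _ => rfl
      right_inv := fun _ => rfl }

theorem card_t_eq {T : ℕ} (hT : T ∈ Set.Icc 1 D.lam) :
    Nat.card {i : D.Coord // D.t i = T} = D.mult T := by
  rw [card_coord _ (Finset.Ioc (D.s (T - 1)) (D.s T)), Nat.card_Ioc, ← s_pred_add_mult hT.1,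
    Nat.add_sub_cancel_left]
  intro i
  have := D.s_mono hT.2
  change _ ≤ D.m at this
  rw [Finset.mem_Ioc]
  constructor
  · rintro ⟨h1, h2⟩
    exact ⟨Finset.mem_Icc.2 ⟨by omega, by omega⟩, (t_eq_iff (i := i) (by omega) hT.1).2 ⟨h1, h2⟩⟩
  · rintro ⟨hi, h⟩
    exact (t_eq_iff (Finset.mem_Icc.1 hi).2 hT.1).1 h

theorem prod_coord (p : D.Coord → Prop) [DecidablePred p] (s : Finset ℕ)
    (h : ∀ i, i ∈ s ↔ ∃ hi : i ∈ Finset.Icc 1 D.m, p ⟨i, hi⟩) (f : ℕ → ℕ) :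
    ∏ i ∈ s, f i = ∏ i : D.Coord with p i, f i := by
  symm
  exact Finset.prod_bij (fun i _ => (i : ℕ)) (fun i hi => (h _).2 ⟨i.2, (Finset.mem_filter.1 hi).2⟩)
    (fun _ _ _ _ h => Subtype.ext h) (fun i hi => ⟨⟨i, ((h _).1 hi).1⟩,
      Finset.mem_filter.2 ⟨Finset.mem_univ _, ((h _).1 hi).2⟩, rfl⟩) fun _ _ => rfl

/-- If `j < j'`, then `u` is at most the sum up to `j + 1`, hence at most the sum up to `j'`, which
is less than `u` because `ℓ' > 0`. -/
theorem IsDecomp.unique {u j ℓ j' ℓ' : ℕ} (h : D.IsDecomp u j ℓ) (h' : D.IsDecomp u j' ℓ') :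
    j = j' ∧ ℓ = ℓ' := by
  have key : ∀ {j ℓ j' ℓ' : ℕ}, D.IsDecomp u j ℓ → D.IsDecomp u j' ℓ' → j' ≤ j := by
    intro j ℓ j' ℓ' h h'
    by_contra! hlt
    have h1 : ∑ i ∈ Finset.Icc 1 (j + 1), (D.d i - 1) ≤ ∑ i ∈ Finset.Icc 1 j', (D.d i - 1) :=
      Finset.sum_le_sum_of_subset (Finset.Icc_subset_Icc_right hlt)
    rw [Finset.sum_Icc_succ_top (by omega)] at h1
    obtain ⟨-, -, h2, h3⟩ := h
    obtain ⟨-, h4, -, h5⟩ := h'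
    omega
  obtain rfl := le_antisymm (key h' h) (key h h')
  have h1 := h.2.2.2
  have h2 := h'.2.2.2
  exact ⟨rfl, by omega⟩

variable (D) in
/-- The staircase of the coordinates `1, …, j + 1` and `k`. -/
noncomputable def staircase {j : ℕ} (hj : j < D.m) (k : D.Coord) (hk : D.t k < D.t (j + 1)) :
    Staircase F D.Coord where
  fld := D.fld
  lev i := D.t i
  fld_lt i i' h := by
    have h1 := Finset.mem_Icc.1 i.2
    have h2 := Finset.mem_Icc.1 i'.2
    exact D.strictMonoOn (D.t_spec h1.1 h1.2).1 (D.t_spec h2.1 h2.2).1 h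
  r := D.t (j + 1)
  low i := (i : ℕ) ≤ j + 1
  low_of_lt i h := by
    by_contra! hlt
    exact h.not_ge (t_mono hlt.le (Finset.mem_Icc.1 i.2).2)
  lev_le_of_low i h := t_mono h hj
  top := ⟨j + 1, Finset.mem_Icc.2 ⟨by omega, hj⟩⟩
  lev_top := rfl
  k := k
  lev_k_lt := hk

/-- Nonzero elements of `A_i` have `(d_i - 1)`-st power `1`, so each factor is the indicator of
zero. -/
theorem eval_h [Finite F] {j : ℕ} {k : D.Coord} {Ω : Finset F} {Q : D.Coord → F} (hQ : Q ∈ D.prod)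
    [Decidable (∀ i : D.Coord, (i : ℕ) ≤ j + 1 → i ≠ k → Q i = 0)] :
    MvPolynomial.eval Q (D.h j k Ω) =
      if ∀ i : D.Coord, (i : ℕ) ≤ j + 1 → i ≠ k → Q i = 0 then ∏ ω ∈ Ω, (Q k - ω) else 0 := by
  classical
  have hfac : ∀ i : D.Coord, (1 - Q i ^ (D.d i - 1) : F) = if Q i = 0 then 1 else 0 := fun i => by
    have := Fintype.ofFinite (D.A i)
    have hd : D.d i = Fintype.card (D.A i) := Nat.card_eq_fintype_card
    split_ifs with h0
    · have : 1 < Fintype.card (D.A i) := Fintype.one_lt_card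
      rw [h0, zero_pow (by omega), sub_zero]
    · have := FiniteField.pow_card_sub_one_eq_one (⟨Q i, hQ i⟩ : D.A i)
        fun h => h0 (congrArg Subtype.val h)
      rw [← hd] at this
      rw [show Q i ^ (D.d i - 1) = 1 from congrArg Subtype.val this, sub_self]
  simp only [h, map_mul, map_prod, map_sub, map_one, map_pow, MvPolynomial.eval_X,
    MvPolynomial.eval_C, hfac]
  split_ifs with h0
  · rw [Finset.prod_eq_one, one_mul]
    intro i hi
    rw [Finset.mem_filter] at hi
    exact if_pos (h0 i hi.2.1 hi.2.2)
  · push Not at h0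
    obtain ⟨i, hi, hik, h0⟩ := h0
    rw [Finset.prod_eq_zero (i := i), zero_mul]
    · exact Finset.mem_filter.2 ⟨Finset.mem_univ _, hi, hik⟩
    · exact if_neg h0

theorem ncard_N_eq [Finite F] {u j ℓ : ℕ} (hj : j < D.m) (h : D.IsDecomp u j ℓ) {k : D.Coord}
    (hkj : (k : ℕ) ≤ j + 1) (hk : D.t k < D.t (j + 1)) :
    (D.N k u).ncard = ((D.staircase hj k hk).words (D.d (j + 1) - ℓ)).ncard := by
  classical
  refine congrArg (Set.ncard (α := D.prod → F)) (Set.ext fun c => ?_)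
  have key : ∀ (γ : F) (Ω : Finset F) (φ : D.prod → D.prod),
      (c = fun P => γ * MvPolynomial.eval (φ P : D.Coord → F) (D.h j k Ω)) ↔
      ∀ P, c P = γ * if ∀ i : D.Coord, (i : ℕ) ≤ j + 1 → i ≠ k → (φ P : D.Coord → F) i = 0 then
        ∏ ω ∈ Ω, ((φ P : D.Coord → F) k - ω) else 0 := fun γ Ω φ => by
    rw [funext_iff]
    exact forall_congr' fun P => by rw [eval_h (φ P).2]
  constructor
  · rintro ⟨j', ℓ', h', -, Ω, hΩ, hcard, γ, hγ, φ, hφ, hc⟩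
    obtain ⟨rfl, rfl⟩ := h.unique h'
    refine ⟨γ, hγ, φ, hφ, Ω, hΩ, hcard, fun P => ((key γ Ω φ).1 hc P).trans ?_⟩
    exact congrArg (γ * ·) (if_congr Iff.rfl rfl rfl)
  · rintro ⟨γ, hγ, φ, hφ, Ω, hΩ, hcard, hc⟩
    refine ⟨j, ℓ, h, hkj, Ω, hΩ, hcard, γ, hγ, φ, hφ, (key γ Ω φ).2 fun P => (hc P).trans ?_⟩
    exact congrArg (γ * ·) (if_congr Iff.rfl rfl rfl)

end NestedProduct

theorem mainTheorem4 {F : Type*} [Field F] [Finite F] (D : NestedProduct F)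
    (u j ℓ r : ℕ) (hj : j < D.m) (hℓ_pos : 0 < ℓ) (hℓ_lt : ℓ < D.d (j + 1) - 1)
    (hu : u = (∑ i ∈ Finset.Icc 1 j, (D.d i - 1)) + ℓ) (hr : r = D.t (j + 1))
    (k : D.Coord) (hkj : (k : ℕ) ≤ j + 1) (htk : D.t k < r) (hdk : D.d (j + 1) - ℓ < D.d k) :
    (D.N k u).ncard =
      (Nat.card F - 1) * (∏ i ∈ (Finset.Icc 1 (j + 1)).erase (k : ℕ), D.d i) *
        (∏ i ∈ Finset.Icc (D.s (D.t k) + 1) (j + 1), D.d i) *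
        gaussBinom (D.A (j + 1)) (D.mult r) (j + 1 - D.s (r - 1)) *
        gaussBinom (D.A k) (D.mult (D.t k)) 1 *
        (D.d k).choose (D.d (j + 1) - ℓ) := by
  classical
  subst hr
  have hdec : D.IsDecomp u j ℓ := ⟨hj, hℓ_pos, hℓ_lt.le, hu⟩
  obtain ⟨hk1, hkm⟩ := Finset.mem_Icc.1 k.2
  have hjs := D.t_spec (k := j + 1) (by omega) hj
  have hE : Nat.card (D.staircase hj k htk).E = D.mult (D.t (j + 1)) :=
    NestedProduct.card_t_eq hjs.1
  have hB : Nat.card (D.staircase hj k htk).B = D.mult (D.t k) :=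
    NestedProduct.card_t_eq (D.t_spec hk1 hkm).1
  have hElow : Nat.card {i : (D.staircase hj k htk).E // (D.staircase hj k htk).low i} =
      j + 1 - D.s (D.t (j + 1) - 1) := by
    rw [Nat.card_congr (Equiv.subtypeSubtypeEquivSubtypeInter
      (fun i => (D.staircase hj k htk).lev i = (D.staircase hj k htk).r)
      (D.staircase hj k htk).low),
      NestedProduct.card_coord _ (Finset.Ioc (D.s (D.t (j + 1) - 1)) (j + 1)), Nat.card_Ioc]
    intro i
    rw [Finset.mem_Ioc]
    constructor
    · rintro ⟨h1, h2⟩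
      exact ⟨Finset.mem_Icc.2 ⟨by omega, by omega⟩,
        (NestedProduct.t_eq_iff (i := i) (by omega) hjs.1.1).2 ⟨h1, h2.trans hjs.2.2⟩, h2⟩
    · rintro ⟨hi, h1, h2⟩
      exact ⟨((NestedProduct.t_eq_iff (Finset.mem_Icc.1 hi).2 hjs.1.1).1 h1).1, h2⟩
  -- The bound proved by `omega` is `2 ≤ d_{j+1} - ℓ`, the existence of two non-roots.
  rw [NestedProduct.ncard_N_eq hj hdec hkj htk, Staircase.ncard_words_eq _ (by omega), hE, hB, hElow,
    NestedProduct.prod_coord (fun i => (D.staircase hj k htk).low i ∧ i ≠ k)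
      ((Finset.Icc 1 (j + 1)).erase (k : ℕ)),
    NestedProduct.prod_coord (fun i => (D.staircase hj k htk).low i ∧ D.t k < D.t i)
      (Finset.Icc (D.s (D.t k) + 1) (j + 1))]
  · rfl
  · intro i
    rw [Finset.mem_Icc]
    constructor
    · rintro ⟨h1, h2⟩
      refine ⟨Finset.mem_Icc.2 ⟨by omega, by omega⟩, h2, ?_⟩
      rw [← not_le, NestedProduct.t_le_iff (by dsimp only; omega)]
      dsimp only
      omega
    · rintro ⟨hi, h1, h2⟩
      rw [← not_le, NestedProduct.t_le_iff (Finset.mem_Icc.1 hi).2] at h2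
      exact ⟨by omega, h1⟩
  · intro i
    rw [Finset.mem_erase, Finset.mem_Icc]
    constructor
    · rintro ⟨h1, h2, h3⟩
      exact ⟨Finset.mem_Icc.2 ⟨by omega, by omega⟩, h3, fun h => h1 (congrArg Subtype.val h)⟩
    · rintro ⟨hi, h1, h2⟩
      exact ⟨fun h => h2 (Subtype.ext h), (Finset.mem_Icc.1 hi).1, h1⟩
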